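/- **Setting.** Let $\kappa$ be a field with a fixed field isomorphism $\mathbb C\cong\kappa$, used to regard complex numbers as elements of $\kappa$. Let $S$ be a subgroup of the circle group $\{z\in\mathbb C:|z|=1\}$ (for example the whole circle group $\mathbb S^1$, or the group of all complex roots of unity). Let $n\ge 0$, let $G$ be a subgroup of the symmetric group $S_n$, and let $X\subseteq G$ be a subset which is not a subgroup. Let $(\kappa S)^{\otimes n}$ be the tensor power of the group Hopf algebra, on which $G$ acts by permuting the factors: $g(\chi_1\otimes\cdots\otimes\chi_n)$ has $j$-th factor $\chi_{g^{-1}(j)}$. Let $$H=(\kappa S)^{\otimes n}\rtimes\kappa G$$ be the smash product Hopf algebra: $(x\otimes u_g)(y\otimes u_h)=x\,g(y)\otimes u_{gh}$, and the elements $\chi\otimes u_g$ with $\chi=\chi_1\otimes\cdots\otimes\chi_n$, $\chi_i\in S$, $g\in G$, are a basis of $H$ consisting of group-like elements. Let $(p_s)_{s\in G}$ be the basis of $(\kappa G)^*$ dual to $(u_s)_{s\in G}$, let $\tilde A=(\sum_{g\in X}p_g)(\kappa G)^*$ (an algebra with unit $\sum_{g\in X}p_g$), and let $$A'=\kappa[t,t^{-1}]^{\otimes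 n}\otimes\tilde A .$$ Write $t_1^{k_1}\cdots t_n^{k_n}=t^{k_1}\otimes\cdots\otimes t^{k_n}$. Let $\cdot:H\otimes A'\to A'$ be the linear map with, for $g\in G$, $s\in X$, $k\in\mathbb Z^n$, $$(\chi\otimes u_g)\cdot(t_1^{k_1}\cdots t_n^{k_n}\otimes p_s)=\begin{cases}\Big(\prod_{j=1}^n\chi_{gs^{-1}(j)}^{\,k_j}\Big)\,t_1^{k_1}\cdots t_n^{k_n}\otimes p_{sg^{-1}}&\text{if } sg^{-1}\in X,\\ 0&\text{if } sg^{-1}\notin X.\end{cases}$$ Let $\gamma:G\times G\to\kappa^*$ be a normalized $2$-cocycle (for the trivial action of $G$ on $\kappa^*$) which is not a coboundary. Let $\omega,\omega',\tilde w,\tilde w':H\otimes H\to A'$ be the linear maps such that, for $h=\chi\otimes u_g$ and $l=\chi'\otimes u_s$, $$\omega(h,l)=\gamma(g,s)\,\big(h\cdot(l\cdot 1)\big),\qquad \omega'(h,l)=\gamma(g,s)^{-1}\,\big(h\cdot(l\cdot 1)\big),$$ $$\tilde w(h,l)=\gamma(g,s)\,\epsilon(h)\epsilon(l)\,1,\qquad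 \tilde w'(h,l)=\gamma(g,s)^{-1}\,\epsilon(h)\epsilon(l)\,1 .$$ **Definitions.** Let $H$ be a Hopf algebra and $A$ a unital algebra with a linear map $\cdot:H\otimes A\to A$; $*$ denotes the convolution product, and $f_1(h,k)=(h\cdot 1)\epsilon(k)$, $f_2(h,k)=hk\cdot 1$. * $\cdot$ is a *partial action* if $1\cdot a=a$, $h\cdot(ab)=(h_{(1)}\cdot a)(h_{(2)}\cdot b)$ and $h\cdot(k\cdot a)=(h_{(1)}\cdot 1)(h_{(2)}k\cdot a)$. * $(\cdot,\omega,\omega')$ is a *symmetric twisted partial action* if the following hold. First, $1\cdot a=a$, $h\cdot(ab)=(h_{(1)}\cdot a)(h_{(2)}\cdot b)$, $h\cdot(k\cdot 1)=(h_{(1)}\cdot 1)(h_{(2)}k\cdot 1)$. Second, $(h_{(1)}\cdot(l_{(1)}\cdot a))\,\omega(h_{(2)},l_{(2)})=\omega(h_{(1)},l_{(1)})(h_{(2)}l_{(2)}\cdot a)$; $\omega(h,l)=\omega(h_{(1)},l_{(1)})(h_{(2)}l_{(2)}\cdot 1)$; $\omega(h,1)=\omega(1,h)=h\cdot 1$;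 and $(h_{(1)}\cdot\omega(k_{(1)},l_{(1)}))\,\omega(h_{(2)},k_{(2)}l_{(2)})=\omega(h_{(1)},k_{(1)})\,\omega(h_{(2)}k_{(2)},l)$. Third, $f_1,f_2$ are central in the convolution algebra $\operatorname{Hom}(H\otimes H,A)$, $\omega'$ lies in its ideal generated by $f_1*f_2$, and $\omega*\omega'=\omega'*\omega=f_1*f_2$. * If $S_H$, the antipode of $H$, is invertible, a *twisted action* of $H$ on a possibly non-unital algebra $B$ consists of a linear map $\triangleright:H\otimes B\to B$ with $1\triangleright b=b$ and $h\triangleright(ab)=(h_{(1)}\triangleright a)(h_{(2)}\triangleright b)$, and $h\triangleright 1_B=\epsilon(h)1_B$ if $B$ is unital, and a convolution invertible linear map $u:H\otimes H\to M(B)$ to the multiplier algebra with $u(h,1)=u(1,h)=\epsilon(h)1$, $(h_{(1)}\triangleright(l_{(1)}\triangleright a))\,u(h_{(2)},l_{(2)})=u(h_{(1)},l_{(1)})(h_{(2)}l_{(2)}\triangleright a)$ and $(h_{(1)}\mathbin{\overline\triangleright}u(k_{(1)},l_{(1)}))\,u(h_{(2)},k_{(2)}l_{(2)})=u(h_{(1)},k_{(1)})\,u(h_{(2)}k_{(2)},l)$.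 Here $\overline\triangleright:H\otimes M(B)\to M(B)$ is linear with $(h\mathbin{\overline\triangleright}x)b=h_{(1)}\triangleright(x(S_H(h_{(2)})\triangleright b))$ and $b(h\mathbin{\overline\triangleright}x)=h_{(2)}\triangleright((S_H^{-1}(h_{(1)})\triangleright b)x)$. * A symmetric twisted partial action $(\cdot,\omega,\omega')$ of $H$ on $A$ is *globalizable* if there are a twisted action $(\triangleright,u)$ of $H$ on a possibly non-unital algebra $B$ and an injective algebra homomorphism $\varphi:A\to B$ such that $\varphi(A)$ is an ideal of $B$ and, with $i=\varphi(1)$, for all $h,k\in H$, $a\in A$: $\varphi(h\cdot a)=i\,(h\triangleright\varphi(a))$; $\varphi(\omega(h,k))=\big(i(h_{(1)}\triangleright i)\big)\,u(h_{(2)},k_{(1)})\,\big(i(h_{(3)}k_{(2)}\triangleright i)\big)$; and $\varphi(\omega'(h,k))=\big(i(h_{(1)}k_{(1)}\triangleright i)\big)\,u^{-1}(h_{(2)},k_{(2)})\,\big(i(h_{(3)}\triangleright i)\big)$. **Claim.** $H$ is cocommutative, $\cdot$ is a partial action of $H$ on $A'$, and $(\cdot,\omega,\omega')$ is a symmetric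 twisted partial action of $H$ on $A'$. The map $\tilde w$ is convolution invertible with inverse $\tilde w'$, and for all $h,k,l\in H$ $$(h_{(1)}\cdot\tilde w(k_{(1)},l_{(1)}))\,\tilde w(h_{(2)},k_{(2)}l_{(2)})=(h_{(1)}\cdot 1)\,\tilde w(h_{(2)},k_{(1)})\,\tilde w(h_{(3)}k_{(2)},l),$$ $\tilde w(1,h)=\tilde w(h,1)=\epsilon(h)1$, $\omega=f_1*f_2*\tilde w$ and $\omega'=f_1*f_2*\tilde w'$. The symmetric twisted partial action $(\cdot,\omega,\omega')$ is globalizable. -/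

import Mathlib

open scoped TensorProduct
open Coalgebra HopfAlgebra

noncomputable section TensorPower

/-- The algebra map out of a tensor power of an algebra induced by algebra maps on the factors. -/
def piLift {κ ι C D : Type*} [CommRing κ] [Fintype ι] [CommRing C] [Algebra κ C] [CommRing D]
    [Algebra κ D] (f : ι → C →ₐ[κ] D) : (⨂[κ] _ : ι, C) →ₐ[κ] D :=
  PiTensorProduct.liftAlgHom
    ((MultilinearMap.mkPiAlgebra κ ι D).compLinearMap fun i => (f i).toLinearMap)
    (by simp) (by intro x y; simp [Finset.prod_mul_distrib])

theorem piLift_tprod {κ ι C D : Type*} [CommRing κ] [Fintype ι] [CommRing C] [Algebra κ C]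
    [CommRing D] [Algebra κ D] (f : ι → C →ₐ[κ] D) (x : ι → C) :
    piLift f (PiTensorProduct.tprod κ x) = ∏ i, f i (x i) :=
  (PiTensorProduct.lift.tprod _).trans (by simp)

/-- Permutations of the factors: `σ • (c₁ ⊗ ⋯ ⊗ cₙ)` has `j`-th factor `c_{σ⁻¹(j)}`. -/
instance instPermActionPi {κ ι C : Type*} [CommRing κ] [CommRing C] [Algebra κ C] : MulSemiringAction (Equiv.Perm ι) (⨂[κ] _ : ι, C) where
  smul σ x := PiTensorProduct.reindex κ (fun _ => C) σ x
  one_smul x := by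
    change PiTensorProduct.reindex κ (fun _ => C) (Equiv.refl ι) x = x
    rw [PiTensorProduct.reindex_refl]; rfl
  mul_smul σ τ x := (PiTensorProduct.reindex_reindex (R := κ) (s := fun _ => C) τ σ x).symm
  smul_zero σ := map_zero _
  smul_add σ := map_add _
  smul_one σ := PiTensorProduct.reindex_tprod σ _
  smul_mul σ x y := by
    have h : (LinearMap.mul κ (⨂[κ] _ : ι, C)).compr₂ (PiTensorProduct.reindex κ (fun _ => C)
        σ).toLinearMap = (LinearMap.mul κ (⨂[κ] _ : ι, C)).compl₁₂
          (PiTensorProduct.reindex κ (fun _ => C) σ).toLinearMap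
          (PiTensorProduct.reindex κ (fun _ => C) σ).toLinearMap := by
      ext a b
      simp [PiTensorProduct.reindex_tprod]
      rfl
    exact LinearMap.congr_fun₂ h x y

theorem perm_smul_tprod {κ ι C : Type*} [CommRing κ] [CommRing C] [Algebra κ C]
    (σ : Equiv.Perm ι) (c : ι → C) :
    σ • PiTensorProduct.tprod κ c = PiTensorProduct.tprod κ fun j => c (σ⁻¹ j) :=
  PiTensorProduct.reindex_tprod σ c

variable {κ ι C : Type*} [CommRing κ] [Fintype ι] [DecidableEq ι] [CommRing C]

/-- The inclusion `c ↦ 1 ⊗ ⋯ ⊗ c ⊗ ⋯ ⊗ 1` of the `i`-th factor of `C^{⊗ι}`. -/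
def piSingle [Algebra κ C] (i : ι) : C →ₐ[κ] (⨂[κ] _ : ι, C) :=
  PiTensorProduct.singleAlgHom (A := fun _ => C) i

theorem piTensor_algHom_ext {D : Type*} [Algebra κ C] [Semiring D] [Algebra κ D]
    {f g : (⨂[κ] _ : ι, C) →ₐ[κ] D} (h : ∀ i c, f (piSingle i c) = g (piSingle i c)) : f = g :=
  PiTensorProduct.algHom_ext fun i => AlgHom.ext (h i)

theorem piLift_single {D : Type*} [Algebra κ C] [CommRing D] [Algebra κ D] (f : ι → C →ₐ[κ] D)
    (i : ι) (c : C) : piLift f (piSingle i c) = f i c := by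
  rw [piSingle, PiTensorProduct.singleAlgHom_apply, piLift_tprod, Finset.prod_eq_single i]
  · simp
  · intro j _ hj; simp [Pi.mulSingle_eq_of_ne hj]
  · simp

/-- The comultiplication of `C^{⊗ι}`: the algebra map which on the `i`-th factor is
`c ↦ Σ (1 ⊗ ⋯ ⊗ c₁ ⊗ ⋯ ⊗ 1) ⊗ (1 ⊗ ⋯ ⊗ c₂ ⊗ ⋯ ⊗ 1)`. -/
def piComul (κ ι C : Type*) [CommRing κ] [Fintype ι] [DecidableEq ι] [CommRing C]
    [Bialgebra κ C] : (⨂[κ] _ : ι, C) →ₐ[κ] (⨂[κ] _ : ι, C) ⊗[κ] (⨂[κ] _ : ι, C) :=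
  piLift fun i => (Algebra.TensorProduct.map (piSingle i) (piSingle i)).comp
    (Bialgebra.comulAlgHom κ C)

/-- The counit of `C^{⊗ι}`: `c₁ ⊗ ⋯ ⊗ cₙ ↦ ε(c₁) ⋯ ε(cₙ)`. -/
def piCounit (κ ι C : Type*) [CommRing κ] [Fintype ι] [DecidableEq ι] [CommRing C]
    [Bialgebra κ C] : (⨂[κ] _ : ι, C) →ₐ[κ] κ :=
  piLift fun _ => Bialgebra.counitAlgHom κ C

theorem piComul_single [Bialgebra κ C] (i : ι) (c : C) :
    piComul κ ι C (piSingle i c) =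
      Algebra.TensorProduct.map (piSingle i) (piSingle i) (comul (R := κ) c) := by
  rw [piComul, piLift_single]; rfl

theorem piCounit_single [Bialgebra κ C] (i : ι) (c : C) :
    piCounit κ ι C (piSingle i c) = counit (R := κ) c := by
  rw [piCounit, piLift_single]; rfl

instance instBialgebraPi [Bialgebra κ C] : Bialgebra κ (⨂[κ] _ : ι, C) :=
  Bialgebra.ofAlgHom (piComul κ ι C) (piCounit κ ι C)
    (by
      refine piTensor_algHom_ext fun i c => ?_
      have h1 : ∀ t : C ⊗[κ] C, Algebra.TensorProduct.map (piComul κ ι C) (AlgHom.id κ _)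
          (Algebra.TensorProduct.map (piSingle (κ := κ) (ι := ι) i) (piSingle (κ := κ) (ι := ι) i) t) =
          Algebra.TensorProduct.map (Algebra.TensorProduct.map (piSingle (κ := κ) (ι := ι) i) (piSingle (κ := κ) (ι := ι) i))
            (piSingle (κ := κ) (ι := ι) i) ((comul (R := κ) (A := C)).rTensor C t) := by
        intro t
        induction t with
        | zero => simp
        | add x y hx hy => simp only [map_add, hx, hy]
        | tmul x y => simp [piComul_single]
      have h2 : ∀ t : C ⊗[κ] C, Algebra.TensorProduct.map (AlgHom.id κ _) (piComul κ ι C)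
          (Algebra.TensorProduct.map (piSingle (κ := κ) (ι := ι) i) (piSingle (κ := κ) (ι := ι) i) t) =
          Algebra.TensorProduct.map (piSingle (κ := κ) (ι := ι) i)
            (Algebra.TensorProduct.map (piSingle (κ := κ) (ι := ι) i) (piSingle (κ := κ) (ι := ι) i))
            ((comul (R := κ) (A := C)).lTensor C t) := by
        intro t
        induction t with
        | zero => simp
        | add x y hx hy => simp only [map_add, hx, hy]
        | tmul x y => simp [piComul_single]
      have h3 : ∀ t : (C ⊗[κ] C) ⊗[κ] C,
          (Algebra.TensorProduct.assoc κ κ κ (⨂[κ] _ : ι, C) (⨂[κ] _ : ι, C) (⨂[κ] _ : ι, C))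
            (Algebra.TensorProduct.map (Algebra.TensorProduct.map (piSingle (κ := κ) (ι := ι) i)
              (piSingle (κ := κ) (ι := ι) i)) (piSingle (κ := κ) (ι := ι) i) t) =
          Algebra.TensorProduct.map (piSingle (κ := κ) (ι := ι) i)
            (Algebra.TensorProduct.map (piSingle (κ := κ) (ι := ι) i) (piSingle (κ := κ) (ι := ι) i))
            (TensorProduct.assoc κ C C C t) := by
        intro t
        induction t with
        | zero => simp
        | add x y hx hy => simp only [map_add, hx, hy]
        | tmul x y =>
          induction x with
          | zero => simp
          | add x z hx hz => simp only [TensorProduct.add_tmul, map_add, hx, hz]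
          | tmul x z => simp
      change Algebra.TensorProduct.assoc κ κ κ _ _ _ (Algebra.TensorProduct.map (piComul κ ι C)
        (AlgHom.id κ _) (piComul κ ι C (piSingle i c))) =
        Algebra.TensorProduct.map (AlgHom.id κ _) (piComul κ ι C) (piComul κ ι C (piSingle i c))
      rw [piComul_single, h1, h2, h3, Coalgebra.coassoc_apply])
    (by
      refine piTensor_algHom_ext fun i c => ?_
      have h1 : ∀ t : C ⊗[κ] C, Algebra.TensorProduct.map (piCounit κ ι C) (AlgHom.id κ _)
          (Algebra.TensorProduct.map (piSingle (κ := κ) (ι := ι) i) (piSingle (κ := κ) (ι := ι) i) t) =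
          Algebra.TensorProduct.map (AlgHom.id κ κ) (piSingle (κ := κ) (ι := ι) i)
            ((counit (R := κ) (A := C)).rTensor C t) := by
        intro t
        induction t with
        | zero => simp
        | add x y hx hy => simp only [map_add, hx, hy]
        | tmul x y => simp [piCounit_single]
      change Algebra.TensorProduct.map (piCounit κ ι C) (AlgHom.id κ _) (piComul κ ι C (piSingle i c)) =
        (Algebra.TensorProduct.lid κ _).symm (piSingle i c)
      rw [piComul_single, h1, Coalgebra.rTensor_counit_comul]
      simp)
    (by
      refine piTensor_algHom_ext fun i c => ?_
      have h1 : ∀ t : C ⊗[κ] C, Algebra.TensorProduct.map (AlgHom.id κ _) (piCounit κ ι C)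
          (Algebra.TensorProduct.map (piSingle (κ := κ) (ι := ι) i) (piSingle (κ := κ) (ι := ι) i) t) =
          Algebra.TensorProduct.map (piSingle (κ := κ) (ι := ι) i) (AlgHom.id κ κ)
            ((counit (R := κ) (A := C)).lTensor C t) := by
        intro t
        induction t with
        | zero => simp
        | add x y hx hy => simp only [map_add, hx, hy]
        | tmul x y => simp [piCounit_single]
      change Algebra.TensorProduct.map (AlgHom.id κ _) (piCounit κ ι C) (piComul κ ι C (piSingle i c)) =
        (Algebra.TensorProduct.rid κ κ _).symm (piSingle i c)
      rw [piComul_single, h1, Coalgebra.lTensor_counit_comul]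
      simp)

theorem comul_piTensor [Bialgebra κ C] (x : ⨂[κ] _ : ι, C) : comul (R := κ) x = piComul κ ι C x := rfl

theorem counit_piTensor [Bialgebra κ C] (x : ⨂[κ] _ : ι, C) : counit (R := κ) x = piCounit κ ι C x := rfl

/-- The antipode of `C^{⊗ι}`: `c₁ ⊗ ⋯ ⊗ cₙ ↦ S(c₁) ⊗ ⋯ ⊗ S(cₙ)`. -/
def piAntipode (κ ι C : Type*) [CommRing κ] [Fintype ι] [DecidableEq ι] [CommRing C]
    [HopfAlgebra κ C] : (⨂[κ] _ : ι, C) →ₐ[κ] (⨂[κ] _ : ι, C) :=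
  piLift fun i => (piSingle i).comp (antipodeAlgHom κ C)

theorem piAntipode_single [HopfAlgebra κ C] (i : ι) (c : C) :
    piAntipode κ ι C (piSingle i c) = piSingle i (antipode κ c) := by
  rw [piAntipode, piLift_single]; rfl

instance instHopfAlgebraPi [HopfAlgebra κ C] : HopfAlgebra κ (⨂[κ] _ : ι, C) where
  antipode := (piAntipode κ ι C).toLinearMap
  mul_antipode_rTensor_comul := by
    have h : ((Algebra.TensorProduct.lmul' κ (S := ⨂[κ] _ : ι, C)).comp
        ((Algebra.TensorProduct.map (piAntipode κ ι C) (AlgHom.id κ _)).comp (piComul κ ι C))) =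
        (Algebra.ofId κ (⨂[κ] _ : ι, C)).comp (piCounit κ ι C) := by
      refine piTensor_algHom_ext fun i c => ?_
      have h1 : ∀ t : C ⊗[κ] C, Algebra.TensorProduct.lmul' κ (Algebra.TensorProduct.map
          (piAntipode κ ι C) (AlgHom.id κ _) (Algebra.TensorProduct.map (piSingle (ι := ι) i)
            (piSingle i) t)) =
          piSingle i (LinearMap.mul' κ C ((antipode κ).rTensor C t)) := by
        intro t
        induction t with
        | zero => simp
        | add x y hx hy => simp only [map_add, hx, hy]
        | tmul x y => simp [piAntipode_single]
      simp only [AlgHom.comp_apply, piComul_single, h1, mul_antipode_rTensor_comul_apply,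
        piCounit_single, AlgHom.commutes]
      rfl
    exact LinearMap.ext fun x => DFunLike.congr_fun h x
  mul_antipode_lTensor_comul := by
    have h : ((Algebra.TensorProduct.lmul' κ (S := ⨂[κ] _ : ι, C)).comp
        ((Algebra.TensorProduct.map (AlgHom.id κ _) (piAntipode κ ι C)).comp (piComul κ ι C))) =
        (Algebra.ofId κ (⨂[κ] _ : ι, C)).comp (piCounit κ ι C) := by
      refine piTensor_algHom_ext fun i c => ?_
      have h1 : ∀ t : C ⊗[κ] C, Algebra.TensorProduct.lmul' κ (Algebra.TensorProduct.map
          (AlgHom.id κ _) (piAntipode κ ι C) (Algebra.TensorProduct.map (piSingle (ι := ι) i)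
            (piSingle i) t)) =
          piSingle i (LinearMap.mul' κ C ((antipode κ).lTensor C t)) := by
        intro t
        induction t with
        | zero => simp
        | add x y hx hy => simp only [map_add, hx, hy]
        | tmul x y => simp [piAntipode_single]
      simp only [AlgHom.comp_apply, piComul_single, h1, mul_antipode_lTensor_comul_apply,
        piCounit_single, AlgHom.commutes]
      rfl
    exact LinearMap.ext fun x => DFunLike.congr_fun h x


instance instIsCocommPi [Bialgebra κ C] [IsCocomm κ C] : IsCocomm κ (⨂[κ] _ : ι, C) where
  comm_comp_comul := by
    have h : (Algebra.TensorProduct.comm κ (⨂[κ] _ : ι, C) (⨂[κ] _ : ι, C)).toAlgHom.comp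
        (piComul κ ι C) = piComul κ ι C := by
      refine piTensor_algHom_ext fun i c => ?_
      have h1 : ∀ t : C ⊗[κ] C, Algebra.TensorProduct.comm κ (⨂[κ] _ : ι, C) (⨂[κ] _ : ι, C)
          (Algebra.TensorProduct.map (piSingle i) (piSingle i) t) =
          Algebra.TensorProduct.map (piSingle i) (piSingle i) (TensorProduct.comm κ C C t) := by
        intro t
        induction t with
        | zero => simp
        | add x y hx hy => simp only [map_add, hx, hy]
        | tmul x y => simp
      change Algebra.TensorProduct.comm κ _ _ (piComul κ ι C (piSingle i c)) = _
      rw [piComul_single, h1, Coalgebra.comm_comul]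
    exact LinearMap.ext fun x => DFunLike.congr_fun h x

end TensorPower

noncomputable section Smash

/-- The group `G` acts on the Hopf algebra `K` by Hopf algebra automorphisms. -/
class IsHopfAction (κ G K : Type*) [CommRing κ] [Group G] [Ring K] [Bialgebra κ K]
    [MulSemiringAction G K] [SMulCommClass G κ K] : Prop where
  comul_smul : ∀ (g : G) (x : K), comul (R := κ) (g • x) =
    TensorProduct.map (DistribSMul.toLinearMap κ K g) (DistribSMul.toLinearMap κ K g)
      (comul (R := κ) x)
  counit_smul : ∀ (g : G) (x : K), counit (R := κ) (g • x) = counit (R := κ) x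

/-- `K ⋊ κG`: the smash product algebra, with underlying module `⨁_g K u_g = K ⊗ κG`,
`u_g` being group-like, and product `(x u_g)(y u_h) = x (g • y) u_{gh}`. The element `x ⊗ u_g`
is `SkewMonoidAlgebra.single g x`. -/
abbrev SmashGroup (K G : Type*) [Ring K] := SkewMonoidAlgebra K G

namespace SmashGroup

section Coalg

variable {κ G K : Type*} [CommRing κ] [Ring K]

/-- The element `x u_g`, as a linear map in `x`. -/
def ofBase [Module κ K] (g : G) : K →ₗ[κ] SmashGroup K G := SkewMonoidAlgebra.lsingle κ g

/-- The linear map on `⨁_g K u_g` given on the summand `K u_g` by `f g`. -/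
def lift {N : Type*} [Module κ K] [AddCommMonoid N] [Module κ N] (f : G → K →ₗ[κ] N) :
    SmashGroup K G →ₗ[κ] N :=
  (Finsupp.lsum κ f).comp (SkewMonoidAlgebra.coeffLinearEquiv (S := κ)).toLinearMap

theorem lift_single {N : Type*} [Module κ K] [AddCommMonoid N] [Module κ N] (f : G → K →ₗ[κ] N)
    (g : G) (x : K) : lift f (SkewMonoidAlgebra.single g x) = f g x :=
  Finsupp.lsum_single κ f g x

theorem ofBase_apply [Module κ K] (g : G) (x : K) :
    ofBase (κ := κ) g x = SkewMonoidAlgebra.single g x := rfl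

/-- The comultiplication `x u_g ↦ Σ x₁ u_g ⊗ x₂ u_g`. -/
def comulMap (κ G K : Type*) [CommRing κ] [Ring K] [Module κ K] [CoalgebraStruct κ K] :
    SmashGroup K G →ₗ[κ] SmashGroup K G ⊗[κ] SmashGroup K G :=
  lift fun g => (TensorProduct.map (ofBase g) (ofBase g)).comp comul

/-- The counit `x u_g ↦ ε(x)`. -/
def counitMap (κ G K : Type*) [CommRing κ] [Ring K] [Module κ K] [CoalgebraStruct κ K] :
    SmashGroup K G →ₗ[κ] κ :=
  lift fun _ => counit

theorem comulMap_single [Module κ K] [CoalgebraStruct κ K] (g : G) (x : K) :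
    comulMap κ G K (SkewMonoidAlgebra.single g x) =
      TensorProduct.map (ofBase g) (ofBase g) (comul (R := κ) x) := lift_single _ _ _

theorem counitMap_single [Module κ K] [CoalgebraStruct κ K] (g : G) (x : K) :
    counitMap κ G K (SkewMonoidAlgebra.single g x) = counit (R := κ) x := lift_single _ _ _

instance instCoalgebra [Module κ K] [Coalgebra κ K] : Coalgebra κ (SmashGroup K G) where
  comul := comulMap κ G K
  counit := counitMap κ G K
  coassoc := by
    refine SkewMonoidAlgebra.lhom_ext fun g x => ?_
    have h1 : ∀ t : K ⊗[κ] K, (comulMap κ G K).rTensor _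
        (TensorProduct.map (ofBase g) (ofBase g) t) =
        TensorProduct.map (TensorProduct.map (ofBase (κ := κ) g) (ofBase g)) (ofBase g)
          ((comul (R := κ) (A := K)).rTensor K t) := by
      intro t
      induction t with
      | zero => simp
      | add x y hx hy => simp only [map_add, hx, hy]
      | tmul x y => simp [ofBase_apply, comulMap_single]
    have h2 : ∀ t : K ⊗[κ] K, (comulMap κ G K).lTensor _
        (TensorProduct.map (ofBase g) (ofBase g) t) =
        TensorProduct.map (ofBase g) (TensorProduct.map (ofBase (κ := κ) g) (ofBase g))
          ((comul (R := κ) (A := K)).lTensor K t) := by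
      intro t
      induction t with
      | zero => simp
      | add x y hx hy => simp only [map_add, hx, hy]
      | tmul x y => simp [ofBase_apply, comulMap_single]
    have h3 : ∀ t : (K ⊗[κ] K) ⊗[κ] K, TensorProduct.assoc κ _ _ _
        (TensorProduct.map (TensorProduct.map (ofBase (κ := κ) g) (ofBase g)) (ofBase g) t) =
        TensorProduct.map (ofBase g) (TensorProduct.map (ofBase (κ := κ) g) (ofBase g))
          (TensorProduct.assoc κ K K K t) := by
      intro t
      induction t with
      | zero => simp
      | add x y hx hy => simp only [map_add, hx, hy]
      | tmul x y =>
        induction x with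
        | zero => simp
        | add x z hx hz => simp only [TensorProduct.add_tmul, map_add, hx, hz]
        | tmul x z => simp
    simp only [LinearMap.comp_apply, LinearEquiv.coe_coe, comulMap_single]
    rw [h1, h2, h3, Coalgebra.coassoc_apply]
  rTensor_counit_comp_comul := by
    refine SkewMonoidAlgebra.lhom_ext fun g x => ?_
    have h1 : ∀ t : K ⊗[κ] K, (counitMap κ G K).rTensor _
        (TensorProduct.map (ofBase g) (ofBase g) t) =
        (ofBase (κ := κ) g).lTensor κ ((counit (R := κ) (A := K)).rTensor K t) := by
      intro t
      induction t with
      | zero => simp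
      | add x y hx hy => simp only [map_add, hx, hy]
      | tmul x y => simp [ofBase_apply, counitMap_single]
    simp only [LinearMap.comp_apply, comulMap_single]
    rw [h1, Coalgebra.rTensor_counit_comul]
    simp [ofBase_apply]
  lTensor_counit_comp_comul := by
    refine SkewMonoidAlgebra.lhom_ext fun g x => ?_
    have h1 : ∀ t : K ⊗[κ] K, (counitMap κ G K).lTensor _
        (TensorProduct.map (ofBase g) (ofBase g) t) =
        (ofBase (κ := κ) g).rTensor κ ((counit (R := κ) (A := K)).lTensor K t) := by
      intro t
      induction t with
      | zero => simp
      | add x y hx hy => simp only [map_add, hx, hy]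
      | tmul x y => simp [ofBase_apply, counitMap_single]
    simp only [LinearMap.comp_apply, comulMap_single]
    rw [h1, Coalgebra.lTensor_counit_comul]
    simp [ofBase_apply]

theorem comul_single [Module κ K] [Coalgebra κ K] (g : G) (x : K) :
    comul (R := κ) (SkewMonoidAlgebra.single g x : SmashGroup K G) =
      TensorProduct.map (ofBase g) (ofBase g) (comul (R := κ) x) := comulMap_single g x

theorem counit_single [Module κ K] [Coalgebra κ K] (g : G) (x : K) :
    counit (R := κ) (SkewMonoidAlgebra.single g x : SmashGroup K G) = counit (R := κ) x :=
  counitMap_single g x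

instance instIsCocomm [Module κ K] [Coalgebra κ K] [IsCocomm κ K] :
    IsCocomm κ (SmashGroup K G) where
  comm_comp_comul := by
    refine SkewMonoidAlgebra.lhom_ext fun g x => ?_
    have h1 : ∀ t : K ⊗[κ] K, TensorProduct.comm κ _ _
        (TensorProduct.map (ofBase g) (ofBase g) t) =
        TensorProduct.map (ofBase g) (ofBase g) (TensorProduct.comm κ K K t) := by
      intro t
      induction t with
      | zero => simp
      | add x y hx hy => simp only [map_add, hx, hy]
      | tmul x y => simp
    simp only [LinearMap.comp_apply, LinearEquiv.coe_coe, comul_single]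
    rw [h1, Coalgebra.comm_comul]

end Coalg

section Hopf

variable {κ G K : Type*} [CommRing κ] [Group G] [Ring K] [MulSemiringAction G K]

theorem single_mul_single (g h : G) (x y : K) :
    (SkewMonoidAlgebra.single g x : SmashGroup K G) * SkewMonoidAlgebra.single h y =
      SkewMonoidAlgebra.single (g * h) (x * g • y) := SkewMonoidAlgebra.single_mul_single

instance instBialgebra [Bialgebra κ K] [SMulCommClass G κ K] [IsHopfAction κ G K] :
    Bialgebra κ (SmashGroup K G) :=
  Bialgebra.mk' κ (SmashGroup K G)
    (by
      rw [SkewMonoidAlgebra.one_def, counit_single, Bialgebra.counit_one])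
    (by
      intro a b
      induction a using SkewMonoidAlgebra.induction_on with
      | zero => simp
      | add a a' ha ha' => simp only [add_mul, map_add, ha, ha']
      | single g x =>
        induction b using SkewMonoidAlgebra.induction_on with
        | zero => simp
        | add b b' hb hb' => simp only [mul_add, map_add, hb, hb']
        | single h y =>
          rw [single_mul_single, counit_single, counit_single, counit_single, Bialgebra.counit_mul,
            IsHopfAction.counit_smul])
    (by
      rw [SkewMonoidAlgebra.one_def, comul_single, Bialgebra.comul_one]
      rfl)
    (by
      intro a b
      induction a using SkewMonoidAlgebra.induction_on with
      | zero => simp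
      | add a a' ha ha' => simp only [add_mul, map_add, ha, ha']
      | single g x =>
        induction b using SkewMonoidAlgebra.induction_on with
        | zero => simp
        | add b b' hb hb' => simp only [mul_add, map_add, hb, hb']
        | single h y =>
          have key : ∀ s t : K ⊗[κ] K,
              TensorProduct.map (ofBase (κ := κ) (g * h)) (ofBase (g * h))
                (s * TensorProduct.map (DistribSMul.toLinearMap κ K g)
                  (DistribSMul.toLinearMap κ K g) t) =
              TensorProduct.map (ofBase (κ := κ) g) (ofBase g) s *
                TensorProduct.map (ofBase (κ := κ) h) (ofBase h) t := by
            intro s t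
            induction s with
            | zero => simp
            | add s s' hs hs' => simp only [add_mul, map_add, hs, hs']
            | tmul a b =>
              induction t with
              | zero => simp
              | add t t' ht ht' => simp only [mul_add, map_add, ht, ht']
              | tmul c d => simp [ofBase_apply]
          rw [single_mul_single, comul_single, comul_single, comul_single, Bialgebra.comul_mul,
            IsHopfAction.comul_smul, key])

/-- The antipode `x u_g ↦ u_{g⁻¹} S(x) = (g⁻¹ • S(x)) u_{g⁻¹}`. -/
def antipodeMap (κ G K : Type*) [CommRing κ] [Group G] [Ring K] [MulSemiringAction G K]
    [HopfAlgebra κ K] [SMulCommClass G κ K] : SmashGroup K G →ₗ[κ] SmashGroup K G :=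
  lift fun g => (ofBase g⁻¹).comp ((DistribSMul.toLinearMap κ K g⁻¹).comp (antipode κ))

instance instHopfAlgebra [HopfAlgebra κ K] [SMulCommClass G κ K] [IsHopfAction κ G K] :
    HopfAlgebra κ (SmashGroup K G) where
  antipode := antipodeMap κ G K
  mul_antipode_rTensor_comul := by
    refine SkewMonoidAlgebra.lhom_ext fun g x => ?_
    have h1 : ∀ t : K ⊗[κ] K, LinearMap.mul' κ _ ((antipodeMap κ G K).rTensor _
        (TensorProduct.map (ofBase g) (ofBase g) t)) =
        ofBase (κ := κ) 1 (DistribSMul.toLinearMap κ K g⁻¹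
          (LinearMap.mul' κ K ((antipode κ).rTensor K t))) := by
      intro t
      induction t with
      | zero => simp
      | add x y hx hy => simp only [map_add, hx, hy]
      | tmul x y => simp [ofBase_apply, antipodeMap, lift_single]
    simp only [LinearMap.comp_apply, comul_single, h1, counit_single,
      mul_antipode_rTensor_comul_apply]
    simp [ofBase_apply, smul_algebraMap]
  mul_antipode_lTensor_comul := by
    refine SkewMonoidAlgebra.lhom_ext fun g x => ?_
    have h1 : ∀ t : K ⊗[κ] K, LinearMap.mul' κ _ ((antipodeMap κ G K).lTensor _
        (TensorProduct.map (ofBase g) (ofBase g) t)) =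
        ofBase (κ := κ) 1 (LinearMap.mul' κ K ((antipode κ).lTensor K t)) := by
      intro t
      induction t with
      | zero => simp
      | add x y hx hy => simp only [map_add, hx, hy]
      | tmul x y => simp [ofBase_apply, antipodeMap, lift_single]
    simp only [LinearMap.comp_apply, comul_single, h1, counit_single,
      mul_antipode_lTensor_comul_apply]
    simp [ofBase_apply]

end Hopf

end SmashGroup

section PermHopf

variable {κ ι C : Type*} [CommRing κ] [DecidableEq ι] [CommRing C]

instance instSMulCommPi [Algebra κ C] (G : Subgroup (Equiv.Perm ι)) :
    SMulCommClass G κ (⨂[κ] _ : ι, C) where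
  smul_comm g c x := map_smul (PiTensorProduct.reindex κ (fun _ => C) (g : Equiv.Perm ι)) c x

theorem smul_piSingle [Algebra κ C] (σ : Equiv.Perm ι) (i : ι) (c : C) :
    σ • piSingle (κ := κ) i c = piSingle (σ i) c := by
  simp only [piSingle, PiTensorProduct.singleAlgHom_apply, perm_smul_tprod]
  congr 1
  funext j
  by_cases h : j = σ i
  · subst h; simp
  · have h' : σ⁻¹ j ≠ i := fun e => h (by simp [← e])
    exact (Pi.mulSingle_eq_of_ne (M := fun _ : ι => C) h' c).trans
      (Pi.mulSingle_eq_of_ne (M := fun _ : ι => C) h c).symm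

instance instIsHopfActionPi [Fintype ι] [Bialgebra κ C] (G : Subgroup (Equiv.Perm ι)) :
    IsHopfAction κ G (⨂[κ] _ : ι, C) where
  comul_smul g x := by
    have h : (piComul κ ι C).comp (MulSemiringAction.toAlgHom κ (⨂[κ] _ : ι, C) g) =
        (Algebra.TensorProduct.map (MulSemiringAction.toAlgHom κ (⨂[κ] _ : ι, C) g)
          (MulSemiringAction.toAlgHom κ (⨂[κ] _ : ι, C) g)).comp (piComul κ ι C) := by
      refine piTensor_algHom_ext fun i c => ?_
      have h1 : ∀ (j : ι) (c : C), g • piSingle (κ := κ) j c =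
        piSingle ((g : Equiv.Perm ι) j) c := fun j c => smul_piSingle _ j c
      have h2 : ∀ t : C ⊗[κ] C, Algebra.TensorProduct.map
          (MulSemiringAction.toAlgHom κ (⨂[κ] _ : ι, C) g)
          (MulSemiringAction.toAlgHom κ (⨂[κ] _ : ι, C) g)
          (Algebra.TensorProduct.map (piSingle i) (piSingle i) t) =
          Algebra.TensorProduct.map (piSingle ((g : Equiv.Perm ι) i))
            (piSingle ((g : Equiv.Perm ι) i)) t := by
        intro t
        induction t with
        | zero => simp
        | add x y hx hy => simp only [map_add, hx, hy]
        | tmul x y => simp [h1]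
      simp only [AlgHom.comp_apply, MulSemiringAction.toAlgHom_apply, h1, piComul_single, h2]
    exact DFunLike.congr_fun h x
  counit_smul g x := by
    have h : (piCounit κ ι C).comp (MulSemiringAction.toAlgHom κ (⨂[κ] _ : ι, C) g) =
        piCounit κ ι C := by
      refine piTensor_algHom_ext fun i c => ?_
      have h1 : g • piSingle (κ := κ) i c =
        piSingle ((g : Equiv.Perm ι) i) c := smul_piSingle _ i c
      simp only [AlgHom.comp_apply, MulSemiringAction.toAlgHom_apply, h1, piCounit_single]
    exact DFunLike.congr_fun h x

end PermHopf

end Smash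

noncomputable section PartialActions

section Convolution

variable {κ C P Q R : Type*} [CommRing κ] [AddCommGroup C] [Module κ C] [Coalgebra κ C]
  [AddCommGroup P] [Module κ P] [AddCommGroup Q] [Module κ Q] [AddCommGroup R] [Module κ R]

/-- The convolution `c ↦ Σ m(f(c₁), g(c₂))` of two linear maps with respect to a bilinear
pairing `m`. -/
def convPair (m : P →ₗ[κ] Q →ₗ[κ] R) (f : C →ₗ[κ] P) (g : C →ₗ[κ] Q) : C →ₗ[κ] R :=
  (TensorProduct.lift m).comp ((TensorProduct.map f g).comp comul)

/-- The convolution product `f * g : c ↦ Σ f(c₁) g(c₂)` of linear maps from a coalgebra to a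
possibly non-unital algebra. -/
def conv {A : Type*} [NonUnitalRing A] [Module κ A] [IsScalarTower κ A A] [SMulCommClass κ A A]
    (f g : C →ₗ[κ] A) : C →ₗ[κ] A :=
  (WithConv.toConv f * WithConv.toConv g).ofConv

/-- The unit `c ↦ ε(c) 1` of the convolution product. -/
def convUnit (κ C A : Type*) [CommRing κ] [AddCommGroup C] [Module κ C] [Coalgebra κ C] [Ring A]
    [Algebra κ A] : C →ₗ[κ] A :=
  (Algebra.linearMap κ A).comp counit

end Convolution

infixl:70 " ∗ᶜ " => conv

section Maps

variable {κ H A X : Type*} [CommRing κ] [Ring H] [Bialgebra κ H] [AddCommGroup A] [Module κ A]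
  [AddCommGroup X] [Module κ X]

/-- `h ⊗ x ↦ h · g(x)`, where `·` is the bilinear map `act`. -/
def actOn (act : H →ₗ[κ] A →ₗ[κ] A) (g : X →ₗ[κ] A) : H ⊗[κ] X →ₗ[κ] A :=
  (TensorProduct.lift act).comp (g.lTensor H)

/-- `h ⊗ k ↦ hk · a`. -/
def mulActOn (act : H →ₗ[κ] A →ₗ[κ] A) (a : A) : H ⊗[κ] H →ₗ[κ] A :=
  (act.flip a).comp (LinearMap.mul' κ H)

/-- `h ⊗ x ↦ f(h) ε(x)`. -/
def firstFactor [Coalgebra κ X] (f : H →ₗ[κ] A) : H ⊗[κ] X →ₗ[κ] A :=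
  f.comp ((TensorProduct.rid κ H).toLinearMap.comp ((counit (R := κ) (A := X)).lTensor H))

/-- `h ⊗ (k ⊗ l) ↦ f(h, kl)`. -/
def precompMulRight (f : H ⊗[κ] H →ₗ[κ] A) : H ⊗[κ] (H ⊗[κ] H) →ₗ[κ] A :=
  f.comp ((LinearMap.mul' κ H).lTensor H)

/-- `h ⊗ (k ⊗ l) ↦ f(hk, l)`. -/
def precompMulLeft (f : H ⊗[κ] H →ₗ[κ] A) : H ⊗[κ] (H ⊗[κ] H) →ₗ[κ] A :=
  f.comp (((LinearMap.mul' κ H).rTensor H).comp (TensorProduct.assoc κ H H H).symm.toLinearMap)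

/-- `h ⊗ (k ⊗ l) ↦ f(h, k) ε(l)`. -/
def precompFirstTwo (f : H ⊗[κ] H →ₗ[κ] A) : H ⊗[κ] (H ⊗[κ] H) →ₗ[κ] A :=
  f.comp (((TensorProduct.rid κ H).toLinearMap.comp
    ((counit (R := κ) (A := H)).lTensor H)).lTensor H)

end Maps

section Partial

variable {κ H A : Type*} [CommRing κ] [Ring H] [Bialgebra κ H] [Ring A] [Algebra κ A]

/-- `f₁(h, k) = (h · 1) ε(k)`. -/
def fOne (act : H →ₗ[κ] A →ₗ[κ] A) : H ⊗[κ] H →ₗ[κ] A := firstFactor (act.flip 1)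

/-- `f₂(h, k) = hk · 1`. -/
def fTwo (act : H →ₗ[κ] A →ₗ[κ] A) : H ⊗[κ] H →ₗ[κ] A := mulActOn act 1

/-- `H` partially measures `A`. -/
structure IsPartialMeasuring (act : H →ₗ[κ] A →ₗ[κ] A) : Prop where
  /-- `1 · a = a` -/
  one_act : ∀ a, act 1 a = a
  /-- `h · (ab) = Σ (h₁ · a)(h₂ · b)` -/
  act_mul : ∀ a b, act.flip (a * b) = act.flip a ∗ᶜ act.flip b
  /-- `h · (k · 1) = Σ (h₁ · 1)(h₂k · 1)` -/
  act_act_one : actOn act (act.flip 1) = fOne act ∗ᶜ mulActOn act 1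

/-- `act` is a partial action of `H` on `A`. -/
structure IsPartialAction (act : H →ₗ[κ] A →ₗ[κ] A) : Prop where
  /-- `1 · a = a` -/
  one_act : ∀ a, act 1 a = a
  /-- `h · (ab) = Σ (h₁ · a)(h₂ · b)` -/
  act_mul : ∀ a b, act.flip (a * b) = act.flip a ∗ᶜ act.flip b
  /-- `h · (k · a) = Σ (h₁ · 1)(h₂k · a)` -/
  act_act : ∀ a, actOn act (act.flip a) = fOne act ∗ᶜ mulActOn act a

/-- `(act, ω)` is a twisted partial action of `H` on `A`. -/
structure IsTwistedPartialAction (act : H →ₗ[κ] A →ₗ[κ] A) (ω : H ⊗[κ] H →ₗ[κ] A) : Prop where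
  measuring : IsPartialMeasuring act
  /-- `Σ (h₁ · (l₁ · a)) ω(h₂, l₂) = Σ ω(h₁, l₁) (h₂l₂ · a)` -/
  twisted : ∀ a, actOn act (act.flip a) ∗ᶜ ω = ω ∗ᶜ mulActOn act a
  /-- `ω(h, l) = Σ ω(h₁, l₁) (h₂l₂ · 1)` -/
  absorb : ω = ω ∗ᶜ mulActOn act 1
  /-- `ω(h, 1) = h · 1` -/
  apply_one : ∀ h, ω (h ⊗ₜ 1) = act h 1
  /-- `ω(1, h) = h · 1` -/
  one_apply : ∀ h, ω (1 ⊗ₜ h) = act h 1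
  /-- `Σ (h₁ · ω(k₁, l₁)) ω(h₂, k₂l₂) = Σ ω(h₁, k₁) ω(h₂k₂, l)` -/
  cocycle : actOn act ω ∗ᶜ precompMulRight ω = precompFirstTwo ω ∗ᶜ precompMulLeft ω

/-- `(act, ω, ω')` is a symmetric twisted partial action of `H` on `A`. -/
structure IsSymmetricTwistedPartialAction (act : H →ₗ[κ] A →ₗ[κ] A)
    (ω ω' : H ⊗[κ] H →ₗ[κ] A) : Prop where
  twistedPartial : IsTwistedPartialAction act ω
  fOne_central : ∀ f, fOne act ∗ᶜ f = f ∗ᶜ fOne act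
  fTwo_central : ∀ f, fTwo act ∗ᶜ f = f ∗ᶜ fTwo act
  /-- `ω'` lies in the ideal `⟨f₁ * f₂⟩` of the convolution algebra. -/
  mem_ideal : WithConv.toConv ω' ∈
    TwoSidedIdeal.span {WithConv.toConv (fOne act ∗ᶜ fTwo act)}
  mul_inv : ω ∗ᶜ ω' = fOne act ∗ᶜ fTwo act
  inv_mul : ω' ∗ᶜ ω = fOne act ∗ᶜ fTwo act

/-- The normalized convolution invertible maps `w : H ⊗ H → A`, with convolution inverse `w'`,
which relate a symmetric twisted partial action to its globalizations. -/
structure IsGlobalizingMap (act : H →ₗ[κ] A →ₗ[κ] A) (ω ω' w w' : H ⊗[κ] H →ₗ[κ] A) : Prop where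
  mul_inv : w ∗ᶜ w' = convUnit κ (H ⊗[κ] H) A
  inv_mul : w' ∗ᶜ w = convUnit κ (H ⊗[κ] H) A
  /-- `Σ (h₁ · w(k₁, l₁)) w(h₂, k₂l₂) = Σ (h₁ · 1) w(h₂, k₁) w(h₃k₂, l)` -/
  cocycle : actOn act w ∗ᶜ precompMulRight w =
    firstFactor (act.flip 1) ∗ᶜ precompFirstTwo w ∗ᶜ precompMulLeft w
  apply_one : ∀ h, w (h ⊗ₜ 1) = algebraMap κ A (counit h)
  one_apply : ∀ h, w (1 ⊗ₜ h) = algebraMap κ A (counit h)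
  /-- `ω(h, k) = Σ (h₁ · 1)(h₂k₁ · 1) w(h₃, k₂)` -/
  eq_conv : ω = fOne act ∗ᶜ fTwo act ∗ᶜ w
  /-- `ω'(h, k) = Σ (h₁ · 1)(h₂k₁ · 1) w'(h₃, k₂)` -/
  eq_conv_inv : ω' = fOne act ∗ᶜ fTwo act ∗ᶜ w'

end Partial

section Multipliers

/-- The multiplier algebra `M(B)` of a possibly non-unital algebra `B`: pairs `(L, R)` of linear
endomorphisms with `L(ab) = L(a)b`, `R(ab) = aR(b)` and `aL(b) = R(a)b`. The product is
`(L, R)(L', R') = (L ∘ L', R' ∘ R)`, whence the opposite algebra in the second component. -/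
def multiplierAlgebra (κ B : Type*) [CommRing κ] [NonUnitalRing B] [Module κ B]
    [IsScalarTower κ B B] [SMulCommClass κ B B] :
    Subalgebra κ (Module.End κ B × (Module.End κ B)ᵐᵒᵖ) where
  carrier := {x | (∀ a b, x.1 (a * b) = x.1 a * b) ∧ (∀ a b, x.2.unop (a * b) = a * x.2.unop b) ∧
    ∀ a b, a * x.1 b = x.2.unop a * b}
  mul_mem' := by
    rintro x y ⟨hx1, hx2, hx3⟩ ⟨hy1, hy2, hy3⟩
    refine ⟨fun a b => ?_, fun a b => ?_, fun a b => ?_⟩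
    · simp [hx1, hy1]
    · simp [hx2, hy2]
    · simp [hx3, hy3]
  add_mem' := by
    rintro x y ⟨hx1, hx2, hx3⟩ ⟨hy1, hy2, hy3⟩
    refine ⟨fun a b => ?_, fun a b => ?_, fun a b => ?_⟩
    · simp [hx1, hy1, add_mul]
    · simp [hx2, hy2, mul_add]
    · simp [hx3, hy3, mul_add, add_mul]
  algebraMap_mem' r := by
    refine ⟨fun a b => ?_, fun a b => ?_, fun a b => ?_⟩
    · simp [smul_mul_assoc]
    · simp [mul_smul_comm]
    · simp [mul_smul_comm, smul_mul_assoc]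

variable (κ B : Type*) [CommRing κ] [NonUnitalRing B] [Module κ B] [IsScalarTower κ B B]
  [SMulCommClass κ B B]

/-- The bilinear map `(x, b) ↦ xb` for a multiplier `x`. -/
def mulLeftMultiplier : multiplierAlgebra κ B →ₗ[κ] B →ₗ[κ] B where
  toFun x := x.1.1
  map_add' _ _ := rfl
  map_smul' _ _ := rfl

/-- The bilinear map `(b, x) ↦ bx` for a multiplier `x`. -/
def mulRightMultiplier : B →ₗ[κ] multiplierAlgebra κ B →ₗ[κ] B :=
  LinearMap.flip
    { toFun x := x.1.2.unop
      map_add' _ _ := rfl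
      map_smul' _ _ := rfl }

end Multipliers

universe u v

section Globalization

/-- A twisted (global) action of a Hopf algebra `H` with invertible antipode on a possibly
non-unital algebra `B`, with convolution invertible cocycle `u : H ⊗ H → M(B)`. -/
structure TwistedAction (κ H B : Type*) [CommRing κ] [Ring H] [HopfAlgebra κ H]
    [NonUnitalRing B] [Module κ B] [IsScalarTower κ B B] [SMulCommClass κ B B] where
  /-- the measuring `h ▷ b` -/
  act : H →ₗ[κ] B →ₗ[κ] B
  one_act : ∀ b, act 1 b = b
  /-- `h ▷ (ab) = Σ (h₁ ▷ a)(h₂ ▷ b)` -/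
  act_mul : ∀ a b, act.flip (a * b) = act.flip a ∗ᶜ act.flip b
  /-- `h ▷ 1 = ε(h) 1` if `B` has a unit `1` -/
  act_unit : ∀ i : B, (∀ b, i * b = b ∧ b * i = b) → ∀ h, act h i = counit (R := κ) h • i
  /-- the inverse of the antipode -/
  antipodeInv : H →ₗ[κ] H
  antipodeInv_antipode : ∀ h, antipodeInv (antipode κ h) = h
  antipode_antipodeInv : ∀ h, antipode κ (antipodeInv h) = h
  /-- the induced map `h ▷ x` on multipliers `x` of `B` -/
  multAct : H →ₗ[κ] multiplierAlgebra κ B →ₗ[κ] multiplierAlgebra κ B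
  /-- `(h ▷ x) b = Σ h₁ ▷ (x (S(h₂) ▷ b))` -/
  multAct_left : ∀ x b, (mulLeftMultiplier κ B).flip b ∘ₗ multAct.flip x =
    convPair LinearMap.id act (mulLeftMultiplier κ B x ∘ₗ act.flip b ∘ₗ antipode κ)
  /-- `b (h ▷ x) = Σ h₂ ▷ ((S⁻¹(h₁) ▷ b) x)` -/
  multAct_right : ∀ x b, mulRightMultiplier κ B b ∘ₗ multAct.flip x =
    convPair LinearMap.id.flip
      ((mulRightMultiplier κ B).flip x ∘ₗ act.flip b ∘ₗ antipodeInv) act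
  /-- the cocycle -/
  u : H ⊗[κ] H →ₗ[κ] multiplierAlgebra κ B
  /-- the convolution inverse of the cocycle -/
  uInv : H ⊗[κ] H →ₗ[κ] multiplierAlgebra κ B
  mul_inv : u ∗ᶜ uInv = convUnit κ (H ⊗[κ] H) (multiplierAlgebra κ B)
  inv_mul : uInv ∗ᶜ u = convUnit κ (H ⊗[κ] H) (multiplierAlgebra κ B)
  /-- `u(h, 1) = ε(h) 1` -/
  apply_one : ∀ h, u (h ⊗ₜ 1) = algebraMap κ _ (counit h)
  /-- `u(1, h) = ε(h) 1` -/
  one_apply : ∀ h, u (1 ⊗ₜ h) = algebraMap κ _ (counit h)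
  /-- `Σ (h₁ ▷ (l₁ ▷ a)) u(h₂, l₂) = Σ u(h₁, l₁) (h₂l₂ ▷ a)` -/
  twisted : ∀ a, convPair (mulRightMultiplier κ B) (actOn act (act.flip a)) u =
    convPair (mulLeftMultiplier κ B) u (mulActOn act a)
  /-- `Σ (h₁ ▷ u(k₁, l₁)) u(h₂, k₂l₂) = Σ u(h₁, k₁) u(h₂k₂, l)` -/
  cocycle : actOn multAct u ∗ᶜ precompMulRight u = precompFirstTwo u ∗ᶜ precompMulLeft u

/-- The partial action `h · b = e (h ▷ b)` on the ideal `eB` induced by a twisted action on `B`. -/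
def TwistedAction.inducedAct {κ H B : Type*} [CommRing κ] [Ring H] [HopfAlgebra κ H]
    [NonUnitalRing B] [Module κ B] [IsScalarTower κ B B] [SMulCommClass κ B B]
    (T : TwistedAction κ H B) (e : B) : H →ₗ[κ] B →ₗ[κ] B :=
  T.act.compr₂ (LinearMap.mulLeft κ e)

/-- The partial cocycle `v(h, k) = Σ (h₁ · e) u(h₂, k₁) (h₃k₂ · e)` induced on `eB`. -/
def TwistedAction.inducedCocycle {κ H B : Type*} [CommRing κ] [Ring H] [HopfAlgebra κ H]
    [NonUnitalRing B] [Module κ B] [IsScalarTower κ B B] [SMulCommClass κ B B]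
    (T : TwistedAction κ H B) (e : B) : H ⊗[κ] H →ₗ[κ] B :=
  convPair (mulRightMultiplier κ B) (firstFactor ((T.inducedAct e).flip e)) T.u ∗ᶜ
    mulActOn (T.inducedAct e) e

/-- The map `v'(h, k) = Σ (h₁k₁ · e) u⁻¹(h₂, k₂) (h₃ · e)` induced on `eB`. -/
def TwistedAction.inducedCocycleInv {κ H B : Type*} [CommRing κ] [Ring H] [HopfAlgebra κ H]
    [NonUnitalRing B] [Module κ B] [IsScalarTower κ B B] [SMulCommClass κ B B]
    (T : TwistedAction κ H B) (e : B) : H ⊗[κ] H →ₗ[κ] B :=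
  convPair (mulRightMultiplier κ B) (mulActOn (T.inducedAct e) e) T.uInv ∗ᶜ
    firstFactor ((T.inducedAct e).flip e)

/-- A globalization of `(A, α, ω, ω')`: a twisted `H`-module algebra `B` and an algebra
monomorphism `φ : A → B` onto an ideal of `B`, which identifies `(A, α, ω, ω')` with the
structure that `B` induces on `φ(A) = φ(1)B`. -/
structure Globalization {κ H A : Type*} [CommRing κ] [Ring H] [HopfAlgebra κ H] [Ring A]
    [Algebra κ A] (α : H →ₗ[κ] A →ₗ[κ] A) (ω ω' : H ⊗[κ] H →ₗ[κ] A)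
    (B : Type*) [NonUnitalRing B] [Module κ B] [IsScalarTower κ B B] [SMulCommClass κ B B]
    extends TwistedAction κ H B where
  φ : A →ₙₐ[κ] B
  injective : Function.Injective φ
  mul_mem : ∀ a b, φ a * b ∈ Set.range φ
  mem_mul : ∀ a b, b * φ a ∈ Set.range φ
  map_act : ∀ h a, φ (α h a) = toTwistedAction.inducedAct (φ 1) h (φ a)
  map_cocycle : ∀ x, φ (ω x) = toTwistedAction.inducedCocycle (φ 1) x
  map_cocycle_inv : ∀ x, φ (ω' x) = toTwistedAction.inducedCocycleInv (φ 1) x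

/-- `(A, α, ω, ω')` is globalizable. -/
def IsGlobalizable {κ : Type*} {H : Type u} {A : Type v} [CommRing κ] [Ring H] [HopfAlgebra κ H]
    [Ring A] [Algebra κ A] (α : H →ₗ[κ] A →ₗ[κ] A) (ω ω' : H ⊗[κ] H →ₗ[κ] A) : Prop :=
  ∃ (B : Type (max u v)) (_ : NonUnitalRing B) (_ : Module κ B) (_ : IsScalarTower κ B B)
    (_ : SMulCommClass κ B B), Nonempty (Globalization α ω ω' B)

end Globalization

end PartialActions

noncomputable section Example

section Objects

variable (κ : Type*) [Field κ] (S : Subgroup Circle) {n : ℕ} (G : Subgroup (Equiv.Perm (Fin n)))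

/-- The Hopf algebra `(κS)^{⊗n}`. -/
abbrev TorusAlgebra (κ : Type*) [Field κ] (S : Subgroup Circle) (n : ℕ) :=
  ⨂[κ] _ : Fin n, MonoidAlgebra κ S

/-- The Hopf algebra `(κS)^{⊗n} ⋊ κG`. -/
def TorusSmash := SmashGroup (TorusAlgebra κ S n) G

instance instRingTorusSmash : Ring (TorusSmash κ S G) :=
  inferInstanceAs (Ring (SmashGroup (TorusAlgebra κ S n) G))

instance instHopfTorusSmash : HopfAlgebra κ (TorusSmash κ S G) :=
  inferInstanceAs (HopfAlgebra κ (SmashGroup (TorusAlgebra κ S n) G))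

/-- The element `(χ₁ ⊗ ⋯ ⊗ χₙ) ⊗ u_g` of `(κS)^{⊗n} ⋊ κG`. -/
def torusElem (χ : Fin n → S) (g : G) : TorusSmash κ S G :=
  (SkewMonoidAlgebra.single g (PiTensorProduct.tprod κ fun j => MonoidAlgebra.single (χ j) 1) :
    SmashGroup (TorusAlgebra κ S n) G)

variable {κ S G} in
/-- The inclusion `x ↦ x ⊗ u_g` of `(κS)^{⊗n}` in `(κS)^{⊗n} ⋊ κG`. -/
def torusIncl (g : G) : TorusAlgebra κ S n →ₗ[κ] TorusSmash κ S G :=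
  (SmashGroup.ofBase g : TorusAlgebra κ S n →ₗ[κ] SmashGroup (TorusAlgebra κ S n) G)

variable {κ S G} in
/-- The linear map on `(κS)^{⊗n} ⋊ κG` with `x ⊗ u_g ↦ f g x`. -/
def torusLift {N : Type*} [AddCommGroup N] [Module κ N] (f : G → TorusAlgebra κ S n →ₗ[κ] N) :
    TorusSmash κ S G →ₗ[κ] N :=
  (SmashGroup.lift f : SmashGroup (TorusAlgebra κ S n) G →ₗ[κ] N)

theorem torusLift_elem {N : Type*} [AddCommGroup N] [Module κ N]
    (f : G → TorusAlgebra κ S n →ₗ[κ] N) (χ : Fin n → S) (g : G) :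
    torusLift f (torusElem κ S G χ g) =
      f g (PiTensorProduct.tprod κ fun j => MonoidAlgebra.single (χ j) 1) :=
  SmashGroup.lift_single f g _

/-- The dual algebra `(κG)^*` of the group algebra, with the convolution product. -/
abbrev DualGroupAlgebra := WithConv (MonoidAlgebra κ G →ₗ[κ] κ)

variable {G}

/-- The dual basis element `p_s ∈ (κG)^*`: `p_s(u_g) = δ_{s,g}`. -/
def dualBasis (s : G) : DualGroupAlgebra κ G :=
  WithConv.toConv ((Finsupp.lapply s).comp (MonoidAlgebra.coeffLinearEquiv κ).toLinearMap)

open Classical in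
/-- The idempotent `Σ_{g ∈ X} p_g` of `(κG)^*`. -/
def sumIdempotent (X : Set G) : DualGroupAlgebra κ G :=
  ∑ g ∈ Finset.univ.filter (· ∈ X), dualBasis κ g

theorem dualBasis_single (s g : G) :
    dualBasis κ s (MonoidAlgebra.single g 1) = if g = s then 1 else 0 := by
  classical
  simp [dualBasis, Finsupp.single_apply]

theorem dual_ext {f f' : DualGroupAlgebra κ G}
    (h : ∀ g, f (MonoidAlgebra.single g 1) = f' (MonoidAlgebra.single g 1)) : f = f' := by
  apply WithConv.ofConv_injective
  ext g
  exact h g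

theorem dual_mul_single (f f' : DualGroupAlgebra κ G) (g : G) :
    (f * f') (MonoidAlgebra.single g 1) =
      f (MonoidAlgebra.single g 1) * f' (MonoidAlgebra.single g 1) := by
  rw [LinearMap.convMul_apply, MonoidAlgebra.comul_single]
  simp

theorem sumIdempotent_single (X : Set G) [DecidablePred (· ∈ X)] (g : G) :
    sumIdempotent κ X (MonoidAlgebra.single g 1) = if g ∈ X then 1 else 0 := by
  classical
  simp only [sumIdempotent, WithConv.ofConv_sum, LinearMap.sum_apply, dualBasis_single]
  simp

theorem sumIdempotent_isIdempotentElem (X : Set G) : IsIdempotentElem (sumIdempotent κ X) := by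
  classical
  refine dual_ext κ fun g => ?_
  rw [dual_mul_single, sumIdempotent_single]
  split_ifs <;> simp

/-- The algebra `Ã = (Σ_{g ∈ X} p_g) (κG)^*`, with unit `Σ_{g ∈ X} p_g`. -/
def ATilde (X : Set G) : Type _ := (sumIdempotent_isIdempotentElem κ X).Corner

instance instCommRingATilde (X : Set G) : CommRing (ATilde κ X) :=
  inferInstanceAs (CommRing (sumIdempotent_isIdempotentElem κ X).Corner)

/-- The inclusion of `Ã` in `(κG)^*`. -/
def ATilde.val {κ : Type*} [Field κ] {n : ℕ} {G : Subgroup (Equiv.Perm (Fin n))} {X : Set G}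
    (f : ATilde κ X) : DualGroupAlgebra κ G := f.1

instance instModuleATilde (X : Set G) : Module κ (ATilde κ X) :=
  letI : SMul κ (ATilde κ X) := ⟨fun c f => ⟨c • f.1, by
    have h := (Subsemigroup.mem_corner_iff (sumIdempotent_isIdempotentElem κ X)).mp f.2
    exact (Subsemigroup.mem_corner_iff (sumIdempotent_isIdempotentElem κ X)).mpr
      ⟨by rw [mul_smul_comm, h.1], by rw [smul_mul_assoc, h.2]⟩⟩⟩
  Function.Injective.module κ
    (⟨⟨ATilde.val, rfl⟩, fun _ _ => rfl⟩ : ATilde κ X →+ DualGroupAlgebra κ G)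
    Subtype.val_injective (fun _ _ => rfl)

instance instAlgebraATilde (X : Set G) : Algebra κ (ATilde κ X) :=
  Algebra.ofModule (fun c f f' => Subtype.ext (smul_mul_assoc c f.1 f'.1))
    (fun c f f' => Subtype.ext (mul_smul_comm c f.1 f'.1))

/-- The element `(Σ_{g ∈ X} p_g) p_s` of `Ã`; this is `p_s` if `s ∈ X`, and zero otherwise. -/
def pTilde (X : Set G) (s : G) : ATilde κ X :=
  ⟨sumIdempotent κ X * dualBasis κ s * sumIdempotent κ X, ⟨_, rfl⟩⟩

open Classical in
theorem pTilde_val (X : Set G) (s : G) :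
    (pTilde κ X s).val = if s ∈ X then dualBasis κ s else 0 := by
  refine dual_ext κ fun g => ?_
  change (sumIdempotent κ X * dualBasis κ s * sumIdempotent κ X) _ = _
  rw [dual_mul_single, dual_mul_single, sumIdempotent_single]
  by_cases hs : s ∈ X <;> by_cases hg : g = s <;> simp_all [dualBasis_single]

/-- The linear functional `f ↦ f(u_s)` on `Ã`. -/
def evalTilde (X : Set G) (s : G) : ATilde κ X →ₗ[κ] κ where
  toFun f := f.val (MonoidAlgebra.single s 1)
  map_add' _ _ := rfl
  map_smul' _ _ := rfl

/-- The algebra `κ[t, t⁻¹]^{⊗n}`. -/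
abbrev LaurentPower (κ : Type*) [Field κ] (n : ℕ) := ⨂[κ] _ : Fin n, LaurentPolynomial κ

/-- The algebra `A' = κ[t, t⁻¹]^{⊗n} ⊗ Ã`. -/
def APrime (X : Set G) := LaurentPower κ n ⊗[κ] ATilde κ X

instance instCommRingAPrime (X : Set G) : CommRing (APrime κ X) :=
  inferInstanceAs (CommRing (LaurentPower κ n ⊗[κ] ATilde κ X))

instance instAlgebraAPrime (X : Set G) : Algebra κ (APrime κ X) :=
  inferInstanceAs (Algebra κ (LaurentPower κ n ⊗[κ] ATilde κ X))

/-- The monomial `t₁^{k₁} ⋯ tₙ^{kₙ} = t^{k₁} ⊗ ⋯ ⊗ t^{kₙ}`. -/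
def monomialT (k : Fin n → ℤ) : LaurentPower κ n :=
  PiTensorProduct.tprod κ fun j => (LaurentPolynomial.T (k j) : LaurentPolynomial κ)

/-- The element `t₁^{k₁} ⋯ tₙ^{kₙ} ⊗ p_s` of `A'`, for `s ∈ X` (it is zero if `s ∉ X`). -/
def basisAPrime (X : Set G) (k : Fin n → ℤ) (s : G) : APrime κ X :=
  monomialT κ k ⊗ₜ[κ] pTilde κ X s

end Objects

section Action

variable {κ : Type*} [Field κ] (e : ℂ ≃+* κ) {S : Subgroup Circle} {n : ℕ}
  {G : Subgroup (Equiv.Perm (Fin n))} (X : Set G)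

/-- The bilinear map `(χ, t^k) ↦ χ^k t^k` of `κS × κ[t, t⁻¹]` to `κ[t, t⁻¹]`, where the complex
number `χ` is viewed in `κ` through `e`. -/
def circleAct : MonoidAlgebra κ S →ₗ[κ] LaurentPolynomial κ →ₗ[κ] LaurentPolynomial κ :=
  (Finsupp.lift (LaurentPolynomial κ →ₗ[κ] LaurentPolynomial κ) κ S fun χ =>
    (Finsupp.lift (LaurentPolynomial κ) κ ℤ fun k =>
      e ((χ : Circle) : ℂ) ^ k • LaurentPolynomial.T k).comp
      (AddMonoidAlgebra.coeffLinearEquiv κ).toLinearMap).comp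
    (MonoidAlgebra.coeffLinearEquiv κ).toLinearMap

theorem circleAct_single (χ : S) (k : ℤ) :
    circleAct e (MonoidAlgebra.single χ 1) (LaurentPolynomial.T k) =
      e ((χ : Circle) : ℂ) ^ k • LaurentPolynomial.T k := by
  change Finsupp.lift (LaurentPolynomial κ →ₗ[κ] LaurentPolynomial κ) κ S _ (Finsupp.single χ 1)
    (AddMonoidAlgebra.ofCoeff (Finsupp.single k 1)) = _
  rw [Finsupp.lift_apply, Finsupp.sum_single_index (by simp), one_smul]
  change Finsupp.lift (LaurentPolynomial κ) κ ℤ _ (Finsupp.single k 1) = _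
  rw [Finsupp.lift_apply, Finsupp.sum_single_index (by simp), one_smul]

/-- The bilinear map of `(κS)^{⊗n} × κ[t, t⁻¹]^{⊗n}` to `κ[t, t⁻¹]^{⊗n}` given by
`(χ₁ ⊗ ⋯ ⊗ χₙ, t^{k₁} ⊗ ⋯ ⊗ t^{kₙ}) ↦ χ₁^{k₁} ⋯ χₙ^{kₙ} t^{k₁} ⊗ ⋯ ⊗ t^{kₙ}`. -/
def torusAct : TorusAlgebra κ S n →ₗ[κ] LaurentPower κ n →ₗ[κ] LaurentPower κ n :=
  PiTensorProduct.map₂ fun _ => circleAct e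

/-- For `x ∈ (κS)^{⊗n}`, `a ∈ κ[t, t⁻¹]^{⊗n}` and `f = Σ_{s ∈ X} f(u_s) p_s ∈ Ã`, the value at
`(x, a ⊗ f)` is the sum of the `f(u_s) (x' a) ⊗ p_{sg⁻¹}` over the `s` with `sg⁻¹ ∈ X`, where `x'`
is obtained from `x` by moving the factor at the place `gs⁻¹(j)` to the place `j`. -/
def tensorComponent (g : G) : TorusAlgebra κ S n →ₗ[κ]
    LaurentPower κ n ⊗[κ] ATilde κ X →ₗ[κ] LaurentPower κ n ⊗[κ] ATilde κ X :=
  letI := Fintype.ofFinite G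
  ∑ s : G,
    ((TensorProduct.mapBilinear (RingHom.id κ) (LaurentPower κ n) (ATilde κ X) (LaurentPower κ n)
        (ATilde κ X)).flip ((evalTilde κ X s).smulRight (pTilde κ X (s * g⁻¹)))).comp
      ((torusAct e).comp (DistribSMul.toLinearMap κ (TorusAlgebra κ S n) (s * g⁻¹)))

theorem tensorComponent_tmul [Fintype G] (g : G) (x : TorusAlgebra κ S n) (a : LaurentPower κ n)
    (f : ATilde κ X) :
    tensorComponent e X g x (a ⊗ₜ f) = ∑ s : G, (torusAct e ((s * g⁻¹) • x) a) ⊗ₜ[κ]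
      (evalTilde κ X s f • pTilde κ X (s * g⁻¹)) := by
  rw [tensorComponent, Subsingleton.elim (Fintype.ofFinite G), LinearMap.sum_apply,
    LinearMap.sum_apply]
  rfl

/-- The action `(x, b) ↦ (x ⊗ u_g) · b` of the component `(κS)^{⊗n} u_g` on `A'`. -/
def actComponent (g : G) : TorusAlgebra κ S n →ₗ[κ] APrime κ X →ₗ[κ] APrime κ X :=
  tensorComponent e X g

/-- The partial action of `(κS)^{⊗n} ⋊ κG` on `A'`. See `exampleAct_basis` for the effect on basis
elements. -/
def exampleAct : TorusSmash κ S G →ₗ[κ] APrime κ X →ₗ[κ] APrime κ X :=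
  torusLift (actComponent e X)

open Classical in
/-- `(χ₁ ⊗ ⋯ ⊗ χₙ ⊗ u_g) · (t₁^{k₁} ⋯ tₙ^{kₙ} ⊗ p_s) =
(∏_j χ_{gs⁻¹(j)}^{k_j}) t₁^{k₁} ⋯ tₙ^{kₙ} ⊗ p_{sg⁻¹}` if `sg⁻¹ ∈ X`, and zero otherwise. -/
theorem exampleAct_basis (χ : Fin n → S) (g : G) (k : Fin n → ℤ) {s : G} (hs : s ∈ X) :
    exampleAct e X (torusElem κ S G χ g) (basisAPrime κ X k s) =
      if s * g⁻¹ ∈ X then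
        (∏ j, e ((χ ((g * s⁻¹ : G).1 j) : Circle) : ℂ) ^ k j) •
          basisAPrime κ X k (s * g⁻¹)
      else 0 := by
  let _ := Fintype.ofFinite G
  have h1 : exampleAct e X (torusElem κ S G χ g) (basisAPrime κ X k s) =
      (∑ s' : G, (torusAct e ((s' * g⁻¹) • PiTensorProduct.tprod κ fun j =>
        MonoidAlgebra.single (χ j) 1) (monomialT κ k)) ⊗ₜ[κ]
        (evalTilde κ X s' (pTilde κ X s) • pTilde κ X (s' * g⁻¹)) :
          LaurentPower κ n ⊗[κ] ATilde κ X) := by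
    rw [exampleAct, torusLift_elem]
    exact tensorComponent_tmul e X g _ _ _
  have h2 : ∀ s' : G, evalTilde κ X s' (pTilde κ X s) = if s' = s then 1 else 0 := by
    intro s'
    change (pTilde κ X s).val (MonoidAlgebra.single s' 1) = _
    rw [pTilde_val, if_pos hs, dualBasis_single]
  have h3 : torusAct e ((s * g⁻¹) • PiTensorProduct.tprod κ fun j =>
        MonoidAlgebra.single (χ j) 1) (monomialT κ k) =
      (∏ j, e ((χ ((g * s⁻¹ : G).1 j) : Circle) : ℂ) ^ k j) • monomialT κ k := by
    have h4 : (s * g⁻¹) • (PiTensorProduct.tprod κ fun j =>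
        (MonoidAlgebra.single (χ j) 1 : MonoidAlgebra κ S)) =
        PiTensorProduct.tprod κ fun j => MonoidAlgebra.single (χ ((g * s⁻¹ : G).1 j)) 1 := by
      refine (perm_smul_tprod ((s * g⁻¹ : G) : Equiv.Perm (Fin n)) _).trans ?_
      simp
    rw [h4, torusAct, monomialT, PiTensorProduct.map₂_tprod_tprod, ← MultilinearMap.map_smul_univ]
    congr 1
    funext j
    exact circleAct_single e _ _
  rw [h1, Finset.sum_eq_single s]
  · rw [h2, if_pos rfl, one_smul, h3]
    split_ifs with h
    · exact TensorProduct.smul_tmul' _ _ _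
    · have : pTilde κ X (s * g⁻¹) = 0 := Subtype.ext ((pTilde_val κ X _).trans (if_neg h))
      rw [this]
      exact TensorProduct.tmul_zero _ _
  · intro s' _ hs'
    rw [h2, if_neg hs', zero_smul, TensorProduct.tmul_zero]
  · simp

/-- The linear map `(x ⊗ u_g) ⊗ (y ⊗ u_s) ↦ γ(g, s) (x ⊗ u_g) ⊗ (y ⊗ u_s)`. -/
def twistMap (γ : G → G → κ) :
    TorusSmash κ S G ⊗[κ] TorusSmash κ S G →ₗ[κ] TorusSmash κ S G ⊗[κ] TorusSmash κ S G :=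
  TensorProduct.lift <| torusLift fun g => LinearMap.flip <| torusLift fun s =>
    γ g s • ((TensorProduct.mk κ _ _).compl₁₂ (torusIncl g) (torusIncl s)).flip

theorem twistMap_tmul (γ : G → G → κ) (χ χ' : Fin n → S) (g s : G) :
    twistMap γ (torusElem κ S G χ g ⊗ₜ torusElem κ S G χ' s) =
      γ g s • (torusElem κ S G χ g ⊗ₜ torusElem κ S G χ' s) := by
  rw [twistMap, TensorProduct.lift.tmul, torusLift_elem, LinearMap.flip_apply, torusLift_elem]
  rfl

/-- The linear map with `(h, l) ↦ γ(g, s) (h · (l · 1))` for `h = χ ⊗ u_g`, `l = χ' ⊗ u_s`. -/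
def exampleCocycle (γ : G → G → κ) : TorusSmash κ S G ⊗[κ] TorusSmash κ S G →ₗ[κ] APrime κ X :=
  (actOn (exampleAct e X) ((exampleAct e X).flip 1)).comp (twistMap γ)

/-- The linear map with `(h, l) ↦ γ(g, s) ε(h) ε(l)` for `h = χ ⊗ u_g`, `l = χ' ⊗ u_s`. -/
def exampleMap (γ : G → G → κ) : TorusSmash κ S G ⊗[κ] TorusSmash κ S G →ₗ[κ] APrime κ X :=
  (convUnit κ (TorusSmash κ S G ⊗[κ] TorusSmash κ S G) (APrime κ X)).comp (twistMap γ)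

theorem exampleCocycle_tmul (γ : G → G → κ) (χ χ' : Fin n → S) (g s : G) :
    exampleCocycle e X γ (torusElem κ S G χ g ⊗ₜ torusElem κ S G χ' s) =
      γ g s • exampleAct e X (torusElem κ S G χ g) (exampleAct e X (torusElem κ S G χ' s) 1) := by
  rw [exampleCocycle, LinearMap.comp_apply, twistMap_tmul, map_smul]
  rfl

theorem exampleMap_tmul (γ : G → G → κ) (χ χ' : Fin n → S) (g s : G) :
    exampleMap X γ (torusElem κ S G χ g ⊗ₜ torusElem κ S G χ' s) =
      (γ g s * counit (R := κ) (torusElem κ S G χ g) * counit (R := κ) (torusElem κ S G χ' s)) •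
        (1 : APrime κ X) := by
  rw [exampleMap, LinearMap.comp_apply, twistMap_tmul, map_smul, convUnit, LinearMap.comp_apply,
    TensorProduct.counit_tmul, Algebra.linearMap_apply, Algebra.algebraMap_eq_smul_one, smul_smul,
    smul_eq_mul]
  ring_nf

end Action

/-- A normalized 2-cocycle of the group `G` with values in the trivial `G`-module `M`. -/
structure IsNormalizedTwoCocycle {G M : Type*} [Group G] [CommGroup M] (γ : G → G → M) : Prop where
  apply_one : ∀ g, γ g 1 = 1
  one_apply : ∀ g, γ 1 g = 1
  cocycle : ∀ g h k, γ h k * γ g (h * k) = γ g h * γ (g * h) k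

/-- `γ` is the coboundary of a function `c : G → M`, where `M` is a trivial `G`-module. -/
def IsTwoCoboundary {G M : Type*} [Group G] [CommGroup M] (γ : G → G → M) : Prop :=
  ∃ c : G → M, ∀ g h, γ g h = c g * c h * (c (g * h))⁻¹

end Example

/-! The Hopf algebra `H` is spanned by the group-like elements `χ ⊗ u_g`. Every identity to be
proved is an equality of linear maps out of `H`, `H ⊗ H` or `H ⊗ (H ⊗ H)`, so it may be tested on
pure tensors of these elements. There the convolution product is the pointwise product and counits
are `1`. The Sweedler identities thus become identities in the commutative algebra `A'`, which is
spanned by the `t^k ⊗ p_s` with `s ∈ X`.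

For a group-like `h = χ ⊗ u_g`, the map `a ↦ h · a` is multiplicative, and `h · 1` is the idempotent
which keeps `p_r` when `r * g ∈ X` and kills it otherwise. The main computation is `exampleAct_act`,
the identity `h · (l · a) = (h · 1)(hl · a)`. It holds because the two scalars agree and because
both sides vanish as soon as `l` moves `p_s` out of `X`. It yields `ω(h, l) = γ(g, s) (h · 1)(hl ·
1)`. The axioms for `ω` then split into the cocycle identity for the scalars `γ` and an identity
between commuting idempotents. The same formula displays `ω` as `f₁ * f₂ * w̃`, where `w̃` has the
scalar values `γ(g, s)`.

The globalization takes `B = κ[t, t⁻¹]^{⊗n} ⊗ (κG)^*`, which is `A'` for the full set `X = G`. No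
translate leaves the full set, so `h · 1 = ε(h) 1` and the partial action on `B` is a global one.
The cocycle `u` has the scalars `γ(g, s)` as values. Since scalars are central, the twisting
condition reduces to associativity of the action, and the cocycle condition reduces to that of `γ`.
The map `φ` extends by zero from `X` to `G`, and its image is the ideal `φ(1)B`. Multiplication by
`φ(1)` truncates to `X`, which recovers the partial action (`inclAPrime_exampleAct`) and then `ω`
and `ω'`. -/

noncomputable section GroupLikes

/-! ### Group-like elements in tensor products, tensor powers and smash products. -/

section Generic

variable {κ : Type*} [CommRing κ]

theorem IsGroupLikeElem.tmul {C D : Type*} [AddCommGroup C] [Module κ C] [Coalgebra κ C]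
    [AddCommGroup D] [Module κ D] [Coalgebra κ D] {c : C} {d : D} (hc : IsGroupLikeElem κ c)
    (hd : IsGroupLikeElem κ d) : IsGroupLikeElem κ (c ⊗ₜ[κ] d) where
  counit_eq_one := by simp [TensorProduct.counit_tmul, hc.counit_eq_one, hd.counit_eq_one]
  comul_eq_tmul_self := by
    simp [TensorProduct.comul_tmul, hc.comul_eq_tmul_self, hd.comul_eq_tmul_self]

/-- A group-like element has diagonal comultiplication, so no Sweedler sum remains. This and the
next two lemmas are the means by which all convolution identities become pointwise ones. -/
theorem convPair_apply_groupLike {C P Q R : Type*} [AddCommGroup C] [Module κ C]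
    [Coalgebra κ C] [AddCommGroup P] [Module κ P] [AddCommGroup Q] [Module κ Q] [AddCommGroup R]
    [Module κ R] (m : P →ₗ[κ] Q →ₗ[κ] R) (f : C →ₗ[κ] P) (g : C →ₗ[κ] Q) {c : C}
    (hc : IsGroupLikeElem κ c) : convPair m f g c = m (f c) (g c) := by
  simp [convPair, hc.comul_eq_tmul_self]

theorem conv_apply_groupLike {C A : Type*} [AddCommGroup C] [Module κ C] [Coalgebra κ C]
    [NonUnitalRing A] [Module κ A] [IsScalarTower κ A A] [SMulCommClass κ A A]
    (f g : C →ₗ[κ] A) {c : C} (hc : IsGroupLikeElem κ c) : (f ∗ᶜ g) c = f c * g c := by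
  simp [conv, LinearMap.convMul_apply, hc.comul_eq_tmul_self]

theorem convUnit_apply_groupLike {C A : Type*} [AddCommGroup C] [Module κ C] [Coalgebra κ C]
    [Ring A] [Algebra κ A] {c : C} (hc : IsGroupLikeElem κ c) : convUnit κ C A c = 1 := by
  simp [convUnit, hc.counit_eq_one]

theorem tmul_mul_tmul_of_algebra {A B : Type*} [CommRing A] [Algebra κ A] [CommRing B]
    [Algebra κ B] (a a' : A) (b b' : B) :
    (a ⊗ₜ[κ] b) * (a' ⊗ₜ[κ] b') = (a * a') ⊗ₜ[κ] (b * b') :=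
  Algebra.TensorProduct.tmul_mul_tmul ..

/-- The algebra map that extends the inclusions of the factors is the identity. The factorization is
needed because the coalgebra structure of the tensor power is multiplicative and is known on single
factors. -/
theorem tprod_eq_prod_piSingle {ι C : Type*} [Fintype ι] [DecidableEq ι] [CommRing C]
    [Algebra κ C] (c : ι → C) : PiTensorProduct.tprod κ c = ∏ i, piSingle (κ := κ) i (c i) := by
  have h : piLift (fun i => piSingle (κ := κ) (C := C) i) = AlgHom.id κ (⨂[κ] _ : ι, C) :=
    piTensor_algHom_ext fun i c => piLift_single _ i c
  rw [← piLift_tprod, h]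
  rfl

theorem IsGroupLikeElem.tprod {ι C : Type*} [Fintype ι] [DecidableEq ι] [CommRing C]
    [Bialgebra κ C] {c : ι → C} (hc : ∀ i, IsGroupLikeElem κ (c i)) :
    IsGroupLikeElem κ (PiTensorProduct.tprod κ c) := by
  rw [tprod_eq_prod_piSingle]
  refine Finset.prod_induction _ (IsGroupLikeElem κ) (fun _ _ => IsGroupLikeElem.mul) .one
    fun i _ => ⟨?_, ?_⟩
  · rw [counit_piTensor, piCounit_single, (hc i).counit_eq_one]
  · rw [comul_piTensor, piComul_single, (hc i).comul_eq_tmul_self]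
    simp

theorem IsGroupLikeElem.smash_single {G K : Type*} [Ring K] [Module κ K] [Coalgebra κ K] (g : G)
    {x : K} (hx : IsGroupLikeElem κ x) :
    IsGroupLikeElem κ (SkewMonoidAlgebra.single g x : SmashGroup K G) where
  counit_eq_one := by rw [SmashGroup.counit_single, hx.counit_eq_one]
  comul_eq_tmul_self := by rw [SmashGroup.comul_single, hx.comul_eq_tmul_self]; rfl

end Generic

/-! ### The spanning group-like elements of the smash product. -/

section Torus

variable {κ : Type*} [Field κ] {S : Subgroup Circle} {n : ℕ} {G : Subgroup (Equiv.Perm (Fin n))}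

theorem isGroupLikeElem_torusElem (χ : Fin n → S) (g : G) :
    IsGroupLikeElem κ (torusElem κ S G χ g) :=
  IsGroupLikeElem.smash_single (κ := κ) (K := TorusAlgebra κ S n) g
    (IsGroupLikeElem.tprod fun i => ⟨by simp, by simp⟩)

theorem torusElem_mul (χ χ' : Fin n → S) (g s : G) :
    torusElem κ S G χ g * torusElem κ S G χ' s =
      torusElem κ S G (fun j => χ j * χ' (g.1⁻¹ j)) (g * s) := by
  refine (SmashGroup.single_mul_single (K := TorusAlgebra κ S n) g s _ _).trans
    (congrArg (SkewMonoidAlgebra.single (g * s)) ?_)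
  refine (congrArg (_ * ·) (perm_smul_tprod (g : Equiv.Perm (Fin n)) _)).trans ?_
  rw [PiTensorProduct.tprod_mul_tprod]
  congr 1
  funext j
  simp [MonoidAlgebra.single_mul_single]

theorem torusElem_one : torusElem κ S G 1 1 = 1 := rfl

/-- The elements `χ ⊗ u_g` span. This and the two tensor versions below are the entry point of
nearly every later verification. -/
theorem torusSmash_hom_ext {N : Type*} [AddCommGroup N] [Module κ N]
    {f f' : TorusSmash κ S G →ₗ[κ] N}
    (h : ∀ χ g, f (torusElem κ S G χ g) = f' (torusElem κ S G χ g)) : f = f' := by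
  refine SkewMonoidAlgebra.lhom_ext fun g x => ?_
  have key : f ∘ₗ torusIncl g = f' ∘ₗ torusIncl g := by
    -- On a fixed summand, a linear map out of the tensor power is a multilinear map on `κS`, which
    -- is determined by its values on the basis of group elements.
    refine PiTensorProduct.ext (Module.Basis.ext_multilinear
      (fun _ => Module.Basis.ofRepr (MonoidAlgebra.coeffLinearEquiv κ)) fun χ => h χ g)
  exact LinearMap.congr_fun key x

theorem torusSmash_tensor_ext {N : Type*} [AddCommGroup N] [Module κ N]
    {f f' : TorusSmash κ S G ⊗[κ] TorusSmash κ S G →ₗ[κ] N}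
    (h : ∀ χ g χ' g', f (torusElem κ S G χ g ⊗ₜ torusElem κ S G χ' g') =
      f' (torusElem κ S G χ g ⊗ₜ torusElem κ S G χ' g')) : f = f' :=
  TensorProduct.ext (torusSmash_hom_ext fun χ g => torusSmash_hom_ext fun χ' g' => h χ g χ' g')

theorem torusSmash_tensor_ext₃ {N : Type*} [AddCommGroup N] [Module κ N]
    {f f' : TorusSmash κ S G ⊗[κ] (TorusSmash κ S G ⊗[κ] TorusSmash κ S G) →ₗ[κ] N}
    (h : ∀ χ g χ' g' χ'' g'',
      f (torusElem κ S G χ g ⊗ₜ (torusElem κ S G χ' g' ⊗ₜ torusElem κ S G χ'' g'')) =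
      f' (torusElem κ S G χ g ⊗ₜ (torusElem κ S G χ' g' ⊗ₜ torusElem κ S G χ'' g''))) : f = f' :=
  TensorProduct.ext (torusSmash_hom_ext fun χ g => torusSmash_tensor_ext (h χ g))

end Torus

end GroupLikes

/-! ### The spanning monomials of `A'` and their products. -/

noncomputable section Basis

variable {κ : Type*} [Field κ] {n : ℕ} {G : Subgroup (Equiv.Perm (Fin n))} {X : Set G}

theorem aTilde_ext {f f' : ATilde κ X} (h : ∀ s, evalTilde κ X s f = evalTilde κ X s f') :
    f = f' :=
  Subtype.ext (dual_ext κ h)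

theorem evalTilde_mul (s : G) (f f' : ATilde κ X) :
    evalTilde κ X s (f * f') = evalTilde κ X s f * evalTilde κ X s f' :=
  dual_mul_single κ f.val f'.val s

open Classical in
theorem evalTilde_one (s : G) : evalTilde κ X s 1 = if s ∈ X then 1 else 0 :=
  sumIdempotent_single κ X s

open Classical in
theorem evalTilde_pTilde (s s' : G) :
    evalTilde κ X s' (pTilde κ X s) = if s ∈ X ∧ s' = s then 1 else 0 := by
  change (pTilde κ X s).val (MonoidAlgebra.single s' 1) = _
  rw [pTilde_val]
  by_cases h : s ∈ X
  · simp [h, dualBasis_single]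
  · simp [h]

/-- The unit of the corner takes the value `0` at `u_s`, and evaluation is multiplicative. -/
theorem evalTilde_of_notMem {s : G} (hs : s ∉ X) (f : ATilde κ X) : evalTilde κ X s f = 0 := by
  rw [← one_mul f, evalTilde_mul, evalTilde_one, if_neg hs, zero_mul]

theorem aTilde_eq_sum [Fintype G] (f : ATilde κ X) :
    f = ∑ s : G, evalTilde κ X s f • pTilde κ X s := by
  classical
  refine aTilde_ext fun s => ?_
  simp only [map_sum, map_smul, evalTilde_pTilde, smul_eq_mul]
  rw [Finset.sum_eq_single s (fun s' _ hs' => by simp [hs'.symm]) (by simp)]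
  by_cases hs : s ∈ X
  · simp [hs]
  · simp [hs, evalTilde_of_notMem hs]

theorem pTilde_of_notMem {s : G} (hs : s ∉ X) : pTilde κ X s = 0 :=
  Subtype.ext ((pTilde_val κ X _).trans (if_neg hs))

/-- With this convention, translates that leave `X` need no case distinction: they are simply zero.
-/
theorem basisAPrime_of_notMem (k : Fin n → ℤ) {s : G} (hs : s ∉ X) : basisAPrime κ X k s = 0 := by
  rw [basisAPrime, pTilde_of_notMem hs]
  exact TensorProduct.tmul_zero _ _

theorem pTilde_mul_self (s : G) : pTilde κ X s * pTilde κ X s = pTilde κ X s := by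
  classical
  exact aTilde_ext fun s' => by rw [evalTilde_mul, evalTilde_pTilde]; split_ifs <;> simp

theorem pTilde_mul_of_ne {s s' : G} (h : s ≠ s') : pTilde κ X s * pTilde κ X s' = 0 := by
  classical
  refine aTilde_ext fun r => ?_
  rw [evalTilde_mul, evalTilde_pTilde, evalTilde_pTilde, map_zero]
  by_cases hr : r = s
  · subst hr; simp [h]
  · simp [hr]

theorem monomialT_mul (k k' : Fin n → ℤ) :
    monomialT κ k * monomialT κ k' = monomialT κ (k + k') := by
  rw [monomialT, monomialT, PiTensorProduct.tprod_mul_tprod, monomialT]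
  congr 1
  funext j
  exact (LaurentPolynomial.T_add _ _).symm

/-- The tensor `a ⊗ f`, as an element of `A'`. -/
def aPrimeMk (a : LaurentPower κ n) (f : ATilde κ X) : APrime κ X := a ⊗ₜ[κ] f

theorem aPrimeMk_mul (a b : LaurentPower κ n) (f f' : ATilde κ X) :
    aPrimeMk a f * aPrimeMk b f' = aPrimeMk (a * b) (f * f') :=
  tmul_mul_tmul_of_algebra a b f f'

theorem basisAPrime_mul_self (k k' : Fin n → ℤ) (s : G) :
    basisAPrime κ X k s * basisAPrime κ X k' s = basisAPrime κ X (k + k') s := by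
  refine (aPrimeMk_mul _ _ _ _).trans ?_
  rw [monomialT_mul, pTilde_mul_self]
  rfl

theorem basisAPrime_mul_of_ne (k k' : Fin n → ℤ) {s s' : G} (h : s ≠ s') :
    basisAPrime κ X k s * basisAPrime κ X k' s' = 0 := by
  refine (aPrimeMk_mul _ _ _ _).trans ?_
  rw [pTilde_mul_of_ne h]
  exact TensorProduct.tmul_zero _ _

theorem aPrime_one [Fintype G] : (1 : APrime κ X) = ∑ s : G, basisAPrime κ X 0 s := by
  have h : (1 : ATilde κ X) = ∑ s : G, pTilde κ X s := by
    classical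
    refine aTilde_ext fun s => ?_
    rw [evalTilde_one, map_sum, Finset.sum_eq_single s] <;> simp +contextual [evalTilde_pTilde, eq_comm]
  change (1 : LaurentPower κ n) ⊗ₜ[κ] (1 : ATilde κ X) = _
  rw [h, TensorProduct.tmul_sum]
  rfl

theorem aPrime_hom_ext {N : Type*} [AddCommGroup N] [Module κ N] {f f' : APrime κ X →ₗ[κ] N}
    (h : ∀ k, ∀ s ∈ X, f (basisAPrime κ X k s) = f' (basisAPrime κ X k s)) : f = f' := by
  let _ := Fintype.ofFinite G
  refine TensorProduct.ext (PiTensorProduct.ext (Module.Basis.ext_multilinear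
    (fun _ => Module.Basis.ofRepr (AddMonoidAlgebra.coeffLinearEquiv κ)) fun k => ?_))
  refine LinearMap.ext fun a => ?_
  -- Once the Laurent factor is a monomial, the factor in `Ã` is expanded in the `p_s`; the terms
  -- with `s ∉ X` vanish.
  rw [aTilde_eq_sum a, map_sum, map_sum]
  refine Finset.sum_congr rfl fun s _ => ?_
  rw [map_smul, map_smul]
  congr 1
  by_cases hs : s ∈ X
  · exact h k s hs
  · rw [pTilde_of_notMem hs, map_zero, map_zero]

end Basis

/-! ### The action on monomials. -/

noncomputable section Action

variable {κ : Type*} [Field κ] (e : ℂ ≃+* κ) {S : Subgroup Circle} {n : ℕ}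
  {G : Subgroup (Equiv.Perm (Fin n))} (X : Set G)

/-- The scalar `∏_j χ_{g(j)}^{k_j}`. -/
def torusChar (χ : Fin n → S) (g : G) (k : Fin n → ℤ) : κ :=
  ∏ j, e ((χ (g.1 j) : Circle) : ℂ) ^ k j

theorem torusChar_zero (χ : Fin n → S) (g : G) : torusChar e χ g 0 = 1 := by
  simp [torusChar]

theorem torusChar_one (g : G) (k : Fin n → ℤ) : torusChar e (1 : Fin n → S) g k = 1 := by
  simp [torusChar]

theorem torusChar_add (χ : Fin n → S) (g : G) (k k' : Fin n → ℤ) :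
    torusChar e χ g (k + k') = torusChar e χ g k * torusChar e χ g k' := by
  rw [torusChar, torusChar, torusChar, ← Finset.prod_mul_distrib]
  -- Adding integer exponents requires a nonzero base. The image of a point of the circle under the
  -- isomorphism `e` is nonzero.
  refine Finset.prod_congr rfl fun j _ => zpow_add₀ ?_ _ _
  simp

/-- The factor of `χ'` permuted by `g` is read at the place `g s (j)`, and `g⁻¹ g s (j) = s (j)`.
This matches the product in the smash algebra. -/
theorem torusChar_mul (χ χ' : Fin n → S) (g s : G) (k : Fin n → ℤ) :
    torusChar e (fun j => χ j * χ' (g.1⁻¹ j)) (g * s) k =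
      torusChar e χ (g * s) k * torusChar e χ' s k := by
  rw [torusChar, torusChar, torusChar, ← Finset.prod_mul_distrib]
  refine Finset.prod_congr rfl fun j _ => ?_
  simp [mul_zpow]

theorem exampleAct_basisAPrime (χ : Fin n → S) (g : G) (k : Fin n → ℤ) {s : G} (hs : s ∈ X) :
    exampleAct e X (torusElem κ S G χ g) (basisAPrime κ X k s) =
      torusChar e χ (g * s⁻¹) k • basisAPrime κ X k (s * g⁻¹) := by
  rw [exampleAct_basis e X χ g k hs]
  split_ifs with h
  · rfl
  · rw [basisAPrime_of_notMem k h, smul_zero]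

theorem exampleAct_one_elem (a : APrime κ X) : exampleAct (S := S) e X 1 a = a := by
  rw [← torusElem_one]
  refine LinearMap.congr_fun (f := exampleAct e X (torusElem κ S G 1 1)) (g := LinearMap.id)
    (aPrime_hom_ext fun k s hs => ?_) a
  rw [exampleAct_basisAPrime e X _ _ _ hs, torusChar_one]
  simp

/-- The scalar is multiplicative in the exponent `k`, and right translation preserves orthogonality
of distinct `p_s`. -/
theorem exampleAct_mul (χ : Fin n → S) (g : G) (a b : APrime κ X) :
    exampleAct e X (torusElem κ S G χ g) (a * b) =
      exampleAct e X (torusElem κ S G χ g) a * exampleAct e X (torusElem κ S G χ g) b := by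
  refine LinearMap.congr_fun₂
    (f := (LinearMap.mul κ (APrime κ X)).compr₂ (exampleAct e X (torusElem κ S G χ g)))
    (g := (LinearMap.mul κ (APrime κ X)).compl₁₂ (exampleAct e X (torusElem κ S G χ g))
      (exampleAct e X (torusElem κ S G χ g)))
    (aPrime_hom_ext fun k s hs => aPrime_hom_ext fun k' s' hs' => ?_) a b
  simp only [LinearMap.compr₂_apply, LinearMap.compl₁₂_apply, LinearMap.mul_apply',
    exampleAct_basisAPrime e X _ _ _ hs, exampleAct_basisAPrime e X _ _ _ hs']
  rw [smul_mul_smul_comm]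
  by_cases h : s = s'
  · subst h
    rw [basisAPrime_mul_self, basisAPrime_mul_self, exampleAct_basisAPrime e X _ _ _ hs,
      torusChar_add]
  -- Distinct `s` and `s'` stay distinct after right multiplication by `g⁻¹`, so both sides are
  -- zero.
  · rw [basisAPrime_mul_of_ne _ _ h, basisAPrime_mul_of_ne _ _ (by simpa using h), map_zero,
      smul_zero]

open Classical in
-- The unit involves only the exponent `0`, where all scalars are `1`. Hence `h · 1` is the sum of
-- the `p_{s g⁻¹}` with `s ∈ X`, independently of `χ`, and only the term `s = r * g` meets `p_r`.
theorem exampleAct_one_mul_basisAPrime (χ : Fin n → S) (g : G) (k : Fin n → ℤ) (r : G) :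
    exampleAct e X (torusElem κ S G χ g) 1 * basisAPrime κ X k r =
      if r * g ∈ X then basisAPrime κ X k r else 0 := by
  let _ := Fintype.ofFinite G
  rw [aPrime_one, map_sum, Finset.sum_mul, Finset.sum_eq_single (r * g)]
  · split_ifs with h
    · rw [exampleAct_basisAPrime e X _ _ _ h, torusChar_zero, one_smul, mul_inv_cancel_right,
        basisAPrime_mul_self, zero_add]
    · rw [basisAPrime_of_notMem _ h, map_zero, zero_mul]
  · intro s _ hs
    by_cases h : s ∈ X
    · rw [exampleAct_basisAPrime e X _ _ _ h, smul_mul_assoc,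
        basisAPrime_mul_of_ne _ _ (by rintro rfl; simp at hs), smul_zero]
    · rw [basisAPrime_of_notMem _ h, map_zero, zero_mul]
  · simp

/-- This is the partial action axiom on group-like elements, and all later computations rest on it.
The factor `h · 1` supplies the condition that the intermediate index `s g'⁻¹` lie in `X`. The
product `hl` alone does not see this condition. -/
theorem exampleAct_act (χ χ' : Fin n → S) (g g' : G) (a : APrime κ X) :
    exampleAct e X (torusElem κ S G χ g) (exampleAct e X (torusElem κ S G χ' g') a) =
      exampleAct e X (torusElem κ S G χ g) 1 *
        exampleAct e X (torusElem κ S G χ g * torusElem κ S G χ' g') a := by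
  classical
  refine LinearMap.congr_fun (f := exampleAct e X (torusElem κ S G χ g) ∘ₗ
      exampleAct e X (torusElem κ S G χ' g'))
    (g := LinearMap.mulLeft κ (exampleAct e X (torusElem κ S G χ g) 1) ∘ₗ
      exampleAct e X (torusElem κ S G χ g * torusElem κ S G χ' g'))
    (aPrime_hom_ext fun k s hs => ?_) a
  simp only [LinearMap.comp_apply, LinearMap.mulLeft_apply, torusElem_mul,
    exampleAct_basisAPrime e X _ _ _ hs, map_smul, exampleAct_one_mul_basisAPrime]
  -- Reassociation writes the index as `g * (g' * s⁻¹)`, so that the scalar of the product splits.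
  -- The test for `h · 1` at the final index becomes the test for `s g'⁻¹`.
  rw [mul_assoc, torusChar_mul, show s * (g * g')⁻¹ * g = s * g'⁻¹ by group]
  split_ifs with h
  · rw [exampleAct_basisAPrime e X _ _ _ h, smul_smul, mul_inv_rev, inv_inv, mul_comm,
      show s * (g * g')⁻¹ = s * g'⁻¹ * g⁻¹ by group]
  · rw [basisAPrime_of_notMem _ h, map_zero, smul_zero, smul_zero]

theorem exampleAct_one_mul_self (χ : Fin n → S) (g : G) :
    exampleAct e X (torusElem κ S G χ g) 1 * exampleAct e X (torusElem κ S G χ g) 1 =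
      exampleAct e X (torusElem κ S G χ g) 1 := by
  rw [← exampleAct_mul, one_mul]

/-! ### Values of the auxiliary maps on pure tensors and on group-like elements. -/

section Evaluation

variable {κ H A Y : Type*} [CommRing κ] [Ring H] [Bialgebra κ H] [AddCommGroup A] [Module κ A]
  [AddCommGroup Y] [Module κ Y]

theorem actOn_tmul (act : H →ₗ[κ] A →ₗ[κ] A) (g : Y →ₗ[κ] A) (h : H) (y : Y) :
    actOn act g (h ⊗ₜ y) = act h (g y) := rfl

theorem mulActOn_tmul (act : H →ₗ[κ] A →ₗ[κ] A) (a : A) (h k : H) :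
    mulActOn act a (h ⊗ₜ k) = act (h * k) a := rfl

theorem firstFactor_tmul [Coalgebra κ Y] (f : H →ₗ[κ] A) (h : H) {y : Y}
    (hy : IsGroupLikeElem κ y) : firstFactor f (h ⊗ₜ y) = f h := by
  simp [firstFactor, hy.counit_eq_one]

theorem precompMulRight_tmul (f : H ⊗[κ] H →ₗ[κ] A) (h k l : H) :
    precompMulRight f (h ⊗ₜ (k ⊗ₜ l)) = f (h ⊗ₜ (k * l)) := rfl

theorem precompMulLeft_tmul (f : H ⊗[κ] H →ₗ[κ] A) (h k l : H) :
    precompMulLeft f (h ⊗ₜ (k ⊗ₜ l)) = f ((h * k) ⊗ₜ l) := rfl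

theorem precompFirstTwo_tmul (f : H ⊗[κ] H →ₗ[κ] A) (h k : H) {l : H}
    (hl : IsGroupLikeElem κ l) : precompFirstTwo f (h ⊗ₜ (k ⊗ₜ l)) = f (h ⊗ₜ k) := by
  simp [precompFirstTwo, hl.counit_eq_one]

end Evaluation

theorem fOne_torusElem (χ χ' : Fin n → S) (g g' : G) :
    fOne (exampleAct e X) (torusElem κ S G χ g ⊗ₜ torusElem κ S G χ' g') =
      exampleAct e X (torusElem κ S G χ g) 1 :=
  firstFactor_tmul _ _ (isGroupLikeElem_torusElem _ _)

/-- In this form the cocycle is a scalar times a product of two idempotents, `h · 1` and `hl · 1`.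
-/
theorem exampleCocycle_torusElem (γ : G → G → κ) (χ χ' : Fin n → S) (g s : G) :
    exampleCocycle e X γ (torusElem κ S G χ g ⊗ₜ torusElem κ S G χ' s) =
      γ g s • (exampleAct e X (torusElem κ S G χ g) 1 *
        exampleAct e X (torusElem κ S G χ g * torusElem κ S G χ' s) 1) := by
  rw [exampleCocycle_tmul, exampleAct_act]

theorem exampleMap_torusElem (γ : G → G → κ) (χ χ' : Fin n → S) (g s : G) :
    exampleMap X γ (torusElem κ S G χ g ⊗ₜ torusElem κ S G χ' s) = γ g s • 1 := by
  rw [exampleMap_tmul, (isGroupLikeElem_torusElem χ g).counit_eq_one,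
    (isGroupLikeElem_torusElem χ' s).counit_eq_one, mul_one, mul_one]

theorem conv_torusElem {A : Type*} [NonUnitalRing A] [Module κ A] [IsScalarTower κ A A]
    [SMulCommClass κ A A] (f f' : TorusSmash κ S G →ₗ[κ] A) (χ : Fin n → S) (g : G) :
    (f ∗ᶜ f') (torusElem κ S G χ g) = f (torusElem κ S G χ g) * f' (torusElem κ S G χ g) :=
  conv_apply_groupLike _ _ (isGroupLikeElem_torusElem χ g)

theorem conv_torusElem_tmul {A : Type*} [NonUnitalRing A] [Module κ A] [IsScalarTower κ A A]
    [SMulCommClass κ A A] (f f' : TorusSmash κ S G ⊗[κ] TorusSmash κ S G →ₗ[κ] A)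
    (χ χ' : Fin n → S) (g g' : G) :
    (f ∗ᶜ f') (torusElem κ S G χ g ⊗ₜ torusElem κ S G χ' g') =
      f (torusElem κ S G χ g ⊗ₜ torusElem κ S G χ' g') *
        f' (torusElem κ S G χ g ⊗ₜ torusElem κ S G χ' g') :=
  conv_apply_groupLike _ _
    ((isGroupLikeElem_torusElem χ g).tmul (isGroupLikeElem_torusElem χ' g'))

theorem conv_torusElem_tmul_tmul {A : Type*} [NonUnitalRing A] [Module κ A]
    [IsScalarTower κ A A] [SMulCommClass κ A A]
    (f f' : TorusSmash κ S G ⊗[κ] (TorusSmash κ S G ⊗[κ] TorusSmash κ S G) →ₗ[κ] A)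
    (χ χ' χ'' : Fin n → S) (g g' g'' : G) :
    (f ∗ᶜ f') (torusElem κ S G χ g ⊗ₜ (torusElem κ S G χ' g' ⊗ₜ torusElem κ S G χ'' g'')) =
      f (torusElem κ S G χ g ⊗ₜ (torusElem κ S G χ' g' ⊗ₜ torusElem κ S G χ'' g'')) *
        f' (torusElem κ S G χ g ⊗ₜ (torusElem κ S G χ' g' ⊗ₜ torusElem κ S G χ'' g'')) :=
  conv_apply_groupLike _ _ ((isGroupLikeElem_torusElem χ g).tmul
    ((isGroupLikeElem_torusElem χ' g').tmul (isGroupLikeElem_torusElem χ'' g'')))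

/-! ### Cocommutativity, the partial action, the partial cocycle and the globalizing map. -/

theorem isCocomm_torusSmash : IsCocomm κ (TorusSmash κ S G) :=
  SmashGroup.instIsCocomm (κ := κ) (G := G) (K := TorusAlgebra κ S n)

theorem isPartialAction_exampleAct : IsPartialAction (exampleAct (S := S) e X) where
  one_act := exampleAct_one_elem e X
  act_mul a b := torusSmash_hom_ext fun χ g => by
    rw [conv_torusElem]
    exact exampleAct_mul e X χ g a b
  act_act a := torusSmash_tensor_ext fun χ g χ' g' => by
    rw [conv_torusElem_tmul, fOne_torusElem, mulActOn_tmul, actOn_tmul]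
    exact exampleAct_act e X χ χ' g g' a

theorem exampleCocycle_eq_conv (γ : G → G → κ) :
    exampleCocycle (S := S) e X γ =
      fOne (exampleAct e X) ∗ᶜ fTwo (exampleAct e X) ∗ᶜ exampleMap X γ :=
  torusSmash_tensor_ext fun χ g χ' g' => by
    rw [conv_torusElem_tmul, conv_torusElem_tmul, fOne_torusElem, fTwo, mulActOn_tmul,
      exampleCocycle_torusElem, exampleMap_torusElem, mul_smul_comm, mul_one]

/-- The scalars cancel and the idempotents `h · 1` and `hl · 1` absorb their second copies. -/
theorem exampleCocycle_conv_inv {γ γ' : G → G → κ} (h : ∀ g s, γ g s * γ' g s = 1) :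
    exampleCocycle (S := S) e X γ ∗ᶜ exampleCocycle e X γ' =
      fOne (exampleAct e X) ∗ᶜ fTwo (exampleAct e X) :=
  torusSmash_tensor_ext fun χ g χ' g' => by
    rw [conv_torusElem_tmul, conv_torusElem_tmul, fOne_torusElem, fTwo, mulActOn_tmul,
      exampleCocycle_torusElem, exampleCocycle_torusElem, smul_mul_smul_comm, h, one_smul,
      mul_mul_mul_comm, exampleAct_one_mul_self, torusElem_mul, exampleAct_one_mul_self]

theorem exampleMap_conv_inv {γ γ' : G → G → κ} (h : ∀ g s, γ g s * γ' g s = 1) :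
    exampleMap (S := S) X γ ∗ᶜ exampleMap X γ' =
      convUnit κ (TorusSmash κ S G ⊗[κ] TorusSmash κ S G) (APrime κ X) :=
  torusSmash_tensor_ext fun χ g χ' g' => by
    rw [conv_torusElem_tmul, exampleMap_torusElem, exampleMap_torusElem, smul_mul_smul_comm, h,
      one_smul, mul_one, convUnit_apply_groupLike
        ((isGroupLikeElem_torusElem χ g).tmul (isGroupLikeElem_torusElem χ' g'))]

variable {γ : G → G → κˣ}

theorem exampleCocycle_apply_one (hγ : IsNormalizedTwoCocycle γ) (h : TorusSmash κ S G) :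
    exampleCocycle e X (fun g s => (γ g s : κ)) (h ⊗ₜ 1) = exampleAct e X h 1 := by
  refine LinearMap.congr_fun
    (f := exampleCocycle e X (fun g s => (γ g s : κ)) ∘ₗ (TensorProduct.mk κ _ _).flip 1)
    (g := (exampleAct e X).flip 1) (torusSmash_hom_ext fun χ g => ?_) h
  rw [LinearMap.comp_apply, LinearMap.flip_apply, LinearMap.flip_apply, TensorProduct.mk_apply,
    ← torusElem_one, exampleCocycle_torusElem, torusElem_one, mul_one, exampleAct_one_mul_self,
    hγ.apply_one, Units.val_one, one_smul]

theorem exampleCocycle_one_apply (hγ : IsNormalizedTwoCocycle γ) (h : TorusSmash κ S G) :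
    exampleCocycle e X (fun g s => (γ g s : κ)) (1 ⊗ₜ h) = exampleAct e X h 1 := by
  refine LinearMap.congr_fun
    (f := exampleCocycle e X (fun g s => (γ g s : κ)) ∘ₗ TensorProduct.mk κ _ _ 1)
    (g := (exampleAct e X).flip 1) (torusSmash_hom_ext fun χ g => ?_) h
  rw [LinearMap.comp_apply, LinearMap.flip_apply, TensorProduct.mk_apply,
    ← torusElem_one, exampleCocycle_torusElem, torusElem_one, one_mul, exampleAct_one_elem,
    one_mul, hγ.one_apply, Units.val_one, one_smul]

theorem exampleMap_apply_one (hγ : IsNormalizedTwoCocycle γ) (h : TorusSmash κ S G) :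
    exampleMap X (fun g s => (γ g s : κ)) (h ⊗ₜ 1) = algebraMap κ (APrime κ X) (counit h) := by
  refine LinearMap.congr_fun
    (f := exampleMap X (fun g s => (γ g s : κ)) ∘ₗ (TensorProduct.mk κ _ _).flip 1)
    (g := convUnit κ _ _) (torusSmash_hom_ext fun χ g => ?_) h
  rw [LinearMap.comp_apply, LinearMap.flip_apply, TensorProduct.mk_apply, ← torusElem_one,
    exampleMap_torusElem, hγ.apply_one, Units.val_one, one_smul,
    convUnit_apply_groupLike (isGroupLikeElem_torusElem χ g)]

theorem exampleMap_one_apply (hγ : IsNormalizedTwoCocycle γ) (h : TorusSmash κ S G) :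
    exampleMap X (fun g s => (γ g s : κ)) (1 ⊗ₜ h) = algebraMap κ (APrime κ X) (counit h) := by
  refine LinearMap.congr_fun
    (f := exampleMap X (fun g s => (γ g s : κ)) ∘ₗ TensorProduct.mk κ _ _ 1)
    (g := convUnit κ _ _) (torusSmash_hom_ext fun χ g => ?_) h
  rw [LinearMap.comp_apply, TensorProduct.mk_apply, ← torusElem_one,
    exampleMap_torusElem, hγ.one_apply, Units.val_one, one_smul,
    convUnit_apply_groupLike (isGroupLikeElem_torusElem χ g)]

/-- This is the part of the cocycle identity that is free of `γ`, with `a = h · 1`, `b = hk · 1` and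
`c = hkl · 1`. Both sides equal `abc`. -/
theorem mul_eq_of_idempotents {A : Type*} [CommRing A] {a b c : A} (ha : a * a = a)
    (hb : b * b = b) (hc : c * c = c) : a * (b * (a * (c * (a * c)))) = a * (b * (b * c)) := by
  linear_combination (a * b * c ^ 2 + b * c ^ 2) * ha + a * b * hc - a * c * hb

theorem isTwistedPartialAction_example (hγ : IsNormalizedTwoCocycle γ) :
    IsTwistedPartialAction (exampleAct (S := S) e X)
      (exampleCocycle e X fun g s => (γ g s : κ)) where
  measuring :=
    { one_act := (isPartialAction_exampleAct e X).one_act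
      act_mul := (isPartialAction_exampleAct e X).act_mul
      act_act_one := (isPartialAction_exampleAct e X).act_act 1 }
  twisted a := torusSmash_tensor_ext fun χ g χ' g' => by
    rw [conv_torusElem_tmul, conv_torusElem_tmul, actOn_tmul, LinearMap.flip_apply,
      exampleAct_act, exampleCocycle_torusElem, mulActOn_tmul, mul_smul_comm, smul_mul_assoc,
      mul_mul_mul_comm, exampleAct_one_mul_self, mul_comm _ (exampleAct e X (_ * _) 1), mul_assoc]
  absorb := torusSmash_tensor_ext fun χ g χ' g' => by
    rw [conv_torusElem_tmul, exampleCocycle_torusElem, mulActOn_tmul, smul_mul_assoc, mul_assoc,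
      torusElem_mul, exampleAct_one_mul_self]
  apply_one := exampleCocycle_apply_one e X hγ
  one_apply := exampleCocycle_one_apply e X hγ
  cocycle := torusSmash_tensor_ext₃ fun χ g χ' g' χ'' g'' => by
    have hc : (γ g' g'' : κ) * γ g (g' * g'') = γ g g' * γ (g * g') g'' := by
      exact_mod_cast congrArg Units.val (hγ.cocycle g g' g'')
    rw [conv_torusElem_tmul_tmul, conv_torusElem_tmul_tmul, actOn_tmul, precompMulRight_tmul,
      precompMulLeft_tmul, precompFirstTwo_tmul _ _ _ (isGroupLikeElem_torusElem _ _)]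
    -- Each side becomes a scalar times a product of idempotents. The scalars agree by the cocycle
    -- identity `hc`, which leaves only the idempotents.
    simp only [exampleCocycle_torusElem, map_smul, exampleAct_mul, exampleAct_act,
      torusElem_mul, smul_mul_smul_comm, hc, mul_assoc]
    congr 1
    exact mul_eq_of_idempotents (exampleAct_one_mul_self e X _ _) (exampleAct_one_mul_self e X _ _)
      (exampleAct_one_mul_self e X _ _)

/-- Centrality of `f₁` and `f₂` comes from commutativity of `A'`, since convolution is pointwise on
the spanning group-like tensors. -/
theorem isSymmetricTwistedPartialAction_example (hγ : IsNormalizedTwoCocycle γ) :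
    IsSymmetricTwistedPartialAction (exampleAct (S := S) e X)
      (exampleCocycle e X fun g s => (γ g s : κ))
      (exampleCocycle e X fun g s => ((γ g s)⁻¹ : κ)) where
  twistedPartial := isTwistedPartialAction_example e X hγ
  fOne_central f := torusSmash_tensor_ext fun χ g χ' g' => by
    rw [conv_torusElem_tmul, conv_torusElem_tmul, mul_comm]
  fTwo_central f := torusSmash_tensor_ext fun χ g χ' g' => by
    rw [conv_torusElem_tmul, conv_torusElem_tmul, mul_comm]
  mem_ideal := by
    -- This exhibits `ω'` as a right multiple of the generator `f₁ * f₂`.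
    rw [exampleCocycle_eq_conv e X]
    exact TwoSidedIdeal.mul_mem_right _ _ _ (TwoSidedIdeal.subset_span rfl)
  mul_inv := exampleCocycle_conv_inv e X fun g s => by simp
  inv_mul := exampleCocycle_conv_inv e X fun g s => by simp

theorem isGlobalizingMap_example (hγ : IsNormalizedTwoCocycle γ) :
    IsGlobalizingMap (exampleAct (S := S) e X)
      (exampleCocycle e X fun g s => (γ g s : κ))
      (exampleCocycle e X fun g s => ((γ g s)⁻¹ : κ))
      (exampleMap X fun g s => (γ g s : κ))
      (exampleMap X fun g s => ((γ g s)⁻¹ : κ)) where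
  mul_inv := exampleMap_conv_inv X fun g s => by simp
  inv_mul := exampleMap_conv_inv X fun g s => by simp
  cocycle := torusSmash_tensor_ext₃ fun χ g χ' g' χ'' g'' => by
    have hc : (γ g' g'' : κ) * γ g (g' * g'') = γ g g' * γ (g * g') g'' := by
      exact_mod_cast congrArg Units.val (hγ.cocycle g g' g'')
    -- The values of `w̃` are scalars, so `h` acts on them by `h · 1`. Both sides carry this one
    -- idempotent, and only the cocycle identity for `γ` remains.
    rw [conv_torusElem_tmul_tmul, conv_torusElem_tmul_tmul, conv_torusElem_tmul_tmul, actOn_tmul,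
      precompMulRight_tmul, precompMulLeft_tmul,
      precompFirstTwo_tmul _ _ _ (isGroupLikeElem_torusElem _ _), firstFactor_tmul _ _
        ((isGroupLikeElem_torusElem _ _).tmul (isGroupLikeElem_torusElem _ _)),
      torusElem_mul, torusElem_mul, exampleMap_torusElem, exampleMap_torusElem,
      exampleMap_torusElem, exampleMap_torusElem, map_smul, smul_mul_smul_comm, hc, mul_smul_comm,
      mul_one, mul_one, mul_smul_comm, smul_smul, mul_one, mul_comm (γ g g' : κ)]
    rfl
  apply_one := exampleMap_apply_one X hγ
  one_apply := exampleMap_one_apply X hγ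
  eq_conv := exampleCocycle_eq_conv e X _
  eq_conv_inv := exampleCocycle_eq_conv e X _

end Action

/-! ### Restriction and extension by zero between different sets `X`. -/

noncomputable section Restriction

variable {κ : Type*} [Field κ] {n : ℕ} {G : Subgroup (Equiv.Perm (Fin n))} (X Y : Set G)

/-- The linear map of `Ã_X` to `Ã_Y` with `p_s ↦ p_s` if `s ∈ Y`, and `p_s ↦ 0` otherwise. -/
def resTilde : ATilde κ X →ₗ[κ] ATilde κ Y where
  toFun f := ⟨sumIdempotent κ Y * f.val * sumIdempotent κ Y, ⟨_, rfl⟩⟩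
  map_add' f f' := Subtype.ext <| by
    change _ * (f.val + f'.val) * _ = _ * f.val * _ + _ * f'.val * _
    rw [mul_add, add_mul]
  map_smul' c f := Subtype.ext <| by
    change _ * (c • f.val) * _ = c • (_ * f.val * _)
    rw [mul_smul_comm, smul_mul_assoc]

open Classical in
theorem evalTilde_resTilde (s : G) (f : ATilde κ X) :
    evalTilde κ Y s (resTilde X Y f) = if s ∈ Y then evalTilde κ X s f else 0 := by
  change (sumIdempotent κ Y * f.val * sumIdempotent κ Y) _ = _
  rw [dual_mul_single, dual_mul_single, sumIdempotent_single]
  split_ifs with h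
  · rw [one_mul, mul_one]; rfl
  · simp

theorem resTilde_pTilde {s : G} (hs : s ∈ X) :
    resTilde X Y (pTilde κ X s) = pTilde κ Y s := by
  classical
  refine aTilde_ext fun s' => ?_
  rw [evalTilde_resTilde, evalTilde_pTilde, evalTilde_pTilde]
  by_cases h : s' = s <;> simp [h, hs]

/-- The linear map of `A'_X` to `A'_Y` with `t^k ⊗ p_s ↦ t^k ⊗ p_s` if `s ∈ Y`, and
`t^k ⊗ p_s ↦ 0` otherwise. -/
def resAPrime : APrime κ X →ₗ[κ] APrime κ Y :=
  (resTilde X Y).lTensor (LaurentPower κ n)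

theorem resAPrime_basis (k : Fin n → ℤ) {s : G} (hs : s ∈ X) :
    resAPrime X Y (basisAPrime κ X k s) = basisAPrime κ Y k s :=
  congrArg (monomialT κ k ⊗ₜ[κ] ·) (resTilde_pTilde X Y hs)

theorem resAPrime_mul (a b : APrime κ X) :
    resAPrime X Y (a * b) = resAPrime X Y a * resAPrime X Y b := by
  refine LinearMap.congr_fun₂
    (f := (LinearMap.mul κ (APrime κ X)).compr₂ (resAPrime X Y))
    (g := (LinearMap.mul κ (APrime κ Y)).compl₁₂ (resAPrime X Y) (resAPrime X Y))
    (aPrime_hom_ext fun k s hs => aPrime_hom_ext fun k' s' hs' => ?_) a b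
  simp only [LinearMap.compr₂_apply, LinearMap.compl₁₂_apply, LinearMap.mul_apply',
    resAPrime_basis X Y _ hs, resAPrime_basis X Y _ hs']
  by_cases h : s = s'
  · subst h
    rw [basisAPrime_mul_self, basisAPrime_mul_self, resAPrime_basis X Y _ hs]
  · rw [basisAPrime_mul_of_ne _ _ h, basisAPrime_mul_of_ne _ _ h, map_zero]

variable (κ) in
/-- The inclusion of `A'` in `κ[t, t⁻¹]^{⊗n} ⊗ (κG)^*`. -/
def inclAPrime : APrime κ X →ₙₐ[κ] APrime κ (Set.univ : Set G) :=
  { resAPrime X Set.univ with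
    map_zero' := map_zero _
    map_mul' := resAPrime_mul X Set.univ }

theorem inclAPrime_basis (k : Fin n → ℤ) {s : G} (hs : s ∈ X) :
    inclAPrime κ X (basisAPrime κ X k s) = basisAPrime κ Set.univ k s :=
  resAPrime_basis X Set.univ k hs

theorem inclAPrime_injective : Function.Injective (inclAPrime κ X) := by
  -- Restriction to `X` undoes extension by zero.
  refine Function.LeftInverse.injective (g := resAPrime Set.univ X) fun a =>
    LinearMap.congr_fun (f := resAPrime Set.univ X ∘ₗ resAPrime X Set.univ) (g := LinearMap.id)
      (aPrime_hom_ext fun k s hs => ?_) a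
  rw [LinearMap.comp_apply, resAPrime_basis X _ _ hs, resAPrime_basis _ X _ (Set.mem_univ s)]
  rfl

/-- The image of the unit is the idempotent `Σ_{r ∈ X} p_r`, so truncating to `X` is multiplication
by it. This is what makes the image an ideal and what later recovers the partial action. -/
theorem inclAPrime_resAPrime (b : APrime κ (Set.univ : Set G)) :
    inclAPrime κ X (resAPrime Set.univ X b) = inclAPrime κ X 1 * b := by
  let _ := Fintype.ofFinite G
  refine LinearMap.congr_fun (f := resAPrime X Set.univ ∘ₗ resAPrime Set.univ X)
    (g := LinearMap.mulLeft κ (inclAPrime κ X 1)) (aPrime_hom_ext fun k s _ => ?_) b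
  rw [LinearMap.comp_apply, resAPrime_basis _ X _ (Set.mem_univ s), LinearMap.mulLeft_apply]
  by_cases hs : s ∈ X
  · rw [resAPrime_basis X _ _ hs, ← inclAPrime_basis X k hs, ← map_mul, one_mul]
  -- For `s ∉ X` every summand of `φ(1)` is orthogonal to `p_s`.
  · rw [basisAPrime_of_notMem _ hs, map_zero, aPrime_one, map_sum, Finset.sum_mul]
    refine (Finset.sum_eq_zero fun r _ => ?_).symm
    by_cases hr : r ∈ X
    · rw [inclAPrime_basis X _ hr, basisAPrime_mul_of_ne _ _ (by rintro rfl; exact hs hr)]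
    · rw [basisAPrime_of_notMem _ hr, map_zero, zero_mul]

theorem inclAPrime_mul_mem (a : APrime κ X) (b : APrime κ (Set.univ : Set G)) :
    inclAPrime κ X a * b ∈ Set.range (inclAPrime κ X) :=
  ⟨a * resAPrime Set.univ X b, by
    rw [map_mul, inclAPrime_resAPrime, ← mul_assoc, ← map_mul, mul_one]⟩

end Restriction

/-! ### Multipliers of a unital algebra. -/

noncomputable section UnitalMultipliers

variable {κ B : Type*} [CommRing κ] [Ring B] [Algebra κ B]

variable (κ B) in
/-- The elements of a unital algebra, as multipliers. -/
def toMultiplier : B →ₗ[κ] multiplierAlgebra κ B where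
  toFun b := ⟨(LinearMap.mulLeft κ b, MulOpposite.op (LinearMap.mulRight κ b)),
    fun x y => (mul_assoc b x y).symm, fun x y => mul_assoc x y b,
    fun x y => (mul_assoc x b y).symm⟩
  map_add' x y := Subtype.ext <| Prod.ext (LinearMap.ext fun z => add_mul x y z)
    (congrArg MulOpposite.op (LinearMap.ext fun z => mul_add z x y))
  map_smul' c x := Subtype.ext <| Prod.ext (LinearMap.ext fun z => smul_mul_assoc c x z)
    (congrArg MulOpposite.op (LinearMap.ext fun z => mul_smul_comm c z x))

theorem toMultiplier_one : toMultiplier κ B 1 = 1 :=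
  Subtype.ext <| Prod.ext (LinearMap.ext fun z => one_mul z)
    (congrArg MulOpposite.op (LinearMap.ext fun z => mul_one z))

theorem mulLeftMultiplier_toMultiplier (b c : B) :
    mulLeftMultiplier κ B (toMultiplier κ B b) c = b * c := rfl

theorem mulRightMultiplier_toMultiplier (b c : B) :
    mulRightMultiplier κ B c (toMultiplier κ B b) = c * b := rfl

theorem mulLeftMultiplier_one (b : B) : mulLeftMultiplier κ B 1 b = b := rfl

/-- A multiplier of a unital algebra is multiplication by its value at `1`. The action on
multipliers can therefore be defined through that value. -/
theorem mulLeftMultiplier_eq_mul (x : multiplierAlgebra κ B) (b : B) :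
    mulLeftMultiplier κ B x b = mulLeftMultiplier κ B x 1 * b := by
  rw [← one_mul b]
  refine (x.2.1 1 b).trans ?_
  rw [one_mul]
  rfl

/-- The compatibility of the left and right components, tested against `1`, shows that the same
element governs right multiplication. -/
theorem mulRightMultiplier_eq_mul (x : multiplierAlgebra κ B) (b : B) :
    mulRightMultiplier κ B b x = b * mulLeftMultiplier κ B x 1 :=
  (mul_one _).symm.trans (x.2.2.2 b 1).symm

/-- The map `(h, x) ↦ h ▷ x1` on the multipliers `x` of a unital algebra. -/
def unitalMultAct {H : Type*} [AddCommGroup H] [Module κ H] (act : H →ₗ[κ] B →ₗ[κ] B) :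
    H →ₗ[κ] multiplierAlgebra κ B →ₗ[κ] multiplierAlgebra κ B :=
  (act.compl₂ ((mulLeftMultiplier κ B).flip 1)).compr₂ (toMultiplier κ B)

theorem unitalMultAct_apply {H : Type*} [AddCommGroup H] [Module κ H]
    (act : H →ₗ[κ] B →ₗ[κ] B) (h : H) (x : multiplierAlgebra κ B) :
    unitalMultAct act h x = toMultiplier κ B (act h (mulLeftMultiplier κ B x 1)) := rfl

end UnitalMultipliers

/-! ### The action for `X = G` is global. -/

noncomputable section GlobalAction

variable {κ : Type*} [Field κ] (e : ℂ ≃+* κ) {S : Subgroup Circle} {n : ℕ}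
  {G : Subgroup (Equiv.Perm (Fin n))}

/-- The truncating idempotent `h · 1` keeps every `p_r`, because `r * g` always lies in the full
set. -/
theorem exampleAct_univ_one (χ : Fin n → S) (g : G) :
    exampleAct e Set.univ (torusElem κ S G χ g) 1 = 1 := by
  let _ := Fintype.ofFinite G
  rw [← mul_one (exampleAct e Set.univ (torusElem κ S G χ g) 1), aPrime_one, Finset.mul_sum,
    ← aPrime_one]
  simp only [exampleAct_one_mul_basisAPrime, Set.mem_univ, if_true]
  exact aPrime_one.symm

theorem exampleAct_univ_one_eq_counit (h : TorusSmash κ S G) :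
    exampleAct e (Set.univ : Set G) h 1 = counit (R := κ) h • 1 := by
  refine LinearMap.congr_fun (f := (exampleAct e Set.univ).flip 1)
    (g := (counit (R := κ)).smulRight 1) (torusSmash_hom_ext fun χ g => ?_) h
  rw [LinearMap.flip_apply, exampleAct_univ_one, LinearMap.smulRight_apply,
    (isGroupLikeElem_torusElem χ g).counit_eq_one, one_smul]

/-- The defect factor in the partial action axiom is `1` here. -/
theorem exampleAct_univ_mul_elem (h l : TorusSmash κ S G) (b : APrime κ (Set.univ : Set G)) :
    exampleAct e Set.univ (h * l) b = exampleAct e Set.univ h (exampleAct e Set.univ l b) := by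
  refine LinearMap.congr_fun (f := mulActOn (exampleAct e Set.univ) b)
    (g := actOn (exampleAct e Set.univ) ((exampleAct e Set.univ).flip b))
    (torusSmash_tensor_ext fun χ g χ' g' => ?_) (h ⊗ₜ l)
  rw [mulActOn_tmul, actOn_tmul, LinearMap.flip_apply, exampleAct_act, exampleAct_univ_one,
    one_mul]

end GlobalAction

/-! ### Twisted actions and globalizations from a module algebra and a scalar cocycle. -/

noncomputable section ScalarGlobalization

variable {κ H : Type*} [CommRing κ] [Ring H]

section Ext

variable [Module κ H] {N : Type*} [AddCommGroup N] [Module κ N] {P : Set H}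

theorem tensor_hom_ext_of_span (hP : Submodule.span κ P = ⊤) {f f' : H ⊗[κ] H →ₗ[κ] N}
    (h : ∀ x ∈ P, ∀ y ∈ P, f (x ⊗ₜ y) = f' (x ⊗ₜ y)) : f = f' :=
  TensorProduct.ext <| LinearMap.ext_on hP fun x hx => LinearMap.ext_on hP fun y hy => h x hx y hy

theorem tensor_tensor_hom_ext_of_span (hP : Submodule.span κ P = ⊤)
    {f f' : H ⊗[κ] (H ⊗[κ] H) →ₗ[κ] N}
    (h : ∀ x ∈ P, ∀ y ∈ P, ∀ z ∈ P, f (x ⊗ₜ (y ⊗ₜ z)) = f' (x ⊗ₜ (y ⊗ₜ z))) : f = f' :=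
  TensorProduct.ext <| LinearMap.ext_on hP fun x hx => tensor_hom_ext_of_span hP (h x hx)

end Ext

variable [HopfAlgebra κ H]

section Induced

variable {B : Type*} [NonUnitalRing B] [Module κ B]
  [IsScalarTower κ B B] [SMulCommClass κ B B] (T : TwistedAction κ H B) (i : B) {h k : H}

/-- A scalar value of the multiplier cocycle comes out of the triple product, leaving only the two
truncated translates of `i`. -/
theorem TwistedAction.inducedCocycle_groupLike {c : κ} (hh : IsGroupLikeElem κ h)
    (hk : IsGroupLikeElem κ k) (hc : T.u (h ⊗ₜ k) = algebraMap κ _ c) :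
    T.inducedCocycle i (h ⊗ₜ k) = c • (i * T.act h i * (i * T.act (h * k) i)) := by
  rw [inducedCocycle, conv_apply_groupLike _ _ (hh.tmul hk),
    convPair_apply_groupLike _ _ _ (hh.tmul hk), firstFactor_tmul _ _ hk, mulActOn_tmul, hc,
    ← smul_mul_assoc]
  rfl

theorem TwistedAction.inducedCocycleInv_groupLike {c : κ} (hh : IsGroupLikeElem κ h)
    (hk : IsGroupLikeElem κ k) (hc : T.uInv (h ⊗ₜ k) = algebraMap κ _ c) :
    T.inducedCocycleInv i (h ⊗ₜ k) = c • (i * T.act (h * k) i * (i * T.act h i)) := by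
  rw [inducedCocycleInv, conv_apply_groupLike _ _ (hh.tmul hk),
    convPair_apply_groupLike _ _ _ (hh.tmul hk), firstFactor_tmul _ _ hk, mulActOn_tmul, hc,
    ← smul_mul_assoc]
  rfl

end Induced

/-- The unital algebra `B` is an `H`-module algebra. -/
structure IsModuleAlgebra {B : Type*} [Ring B] [Algebra κ B] (act : H →ₗ[κ] B →ₗ[κ] B) :
    Prop where
  one_act : ∀ b, act 1 b = b
  mul_act : ∀ h l b, act (h * l) b = act h (act l b)
  act_mul : ∀ a b, act.flip (a * b) = act.flip a ∗ᶜ act.flip b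
  act_one : ∀ h, act h 1 = counit (R := κ) h • 1

/-- `σ` restricts to a normalized 2-cocycle with inverse `σ'` on the set `P` of group-like
elements, which spans `H`. -/
structure IsScalarCocycleOn (P : Set H) (σ σ' : H ⊗[κ] H →ₗ[κ] κ) : Prop where
  span_eq_top : Submodule.span κ P = ⊤
  groupLike : ∀ h ∈ P, IsGroupLikeElem κ h
  mul_inv : ∀ h ∈ P, ∀ k ∈ P, σ (h ⊗ₜ k) * σ' (h ⊗ₜ k) = 1
  apply_one : ∀ h ∈ P, σ (h ⊗ₜ 1) = 1
  one_apply : ∀ h ∈ P, σ (1 ⊗ₜ h) = 1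
  cocycle : ∀ h ∈ P, ∀ k ∈ P, ∀ l ∈ P,
    σ (k ⊗ₜ l) * σ (h ⊗ₜ (k * l)) = σ (h ⊗ₜ k) * σ ((h * k) ⊗ₜ l)

variable {P : Set H} {σ σ' : H ⊗[κ] H →ₗ[κ] κ}

/-- The antipode inverts group-like elements, and these span `H`. It is therefore its own inverse,
as the twisted action requires. -/
theorem IsScalarCocycleOn.antipode_antipode (hσ : IsScalarCocycleOn P σ σ') (h : H) :
    antipode κ (antipode κ h) = h := by
  have key : (antipode κ : H →ₗ[κ] H) ∘ₗ antipode κ = LinearMap.id :=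
    LinearMap.ext_on hσ.span_eq_top fun x hx => (hσ.groupLike x hx).antipode_antipode
  exact LinearMap.congr_fun key h

section Algebra

variable {M : Type*} [Ring M] [Algebra κ M]

theorem IsScalarCocycleOn.conv_algebraMap (hσ : IsScalarCocycleOn P σ σ') :
    (Algebra.linearMap κ M ∘ₗ σ) ∗ᶜ (Algebra.linearMap κ M ∘ₗ σ') = convUnit κ (H ⊗[κ] H) M :=
  tensor_hom_ext_of_span hσ.span_eq_top fun h hh k hk => by
    have hg := (hσ.groupLike h hh).tmul (hσ.groupLike k hk)
    rw [conv_apply_groupLike _ _ hg, convUnit_apply_groupLike hg, LinearMap.comp_apply,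
      LinearMap.comp_apply, Algebra.linearMap_apply, Algebra.linearMap_apply, ← map_mul,
      hσ.mul_inv h hh k hk, map_one]

theorem IsScalarCocycleOn.conv_algebraMap_inv (hσ : IsScalarCocycleOn P σ σ') :
    (Algebra.linearMap κ M ∘ₗ σ') ∗ᶜ (Algebra.linearMap κ M ∘ₗ σ) = convUnit κ (H ⊗[κ] H) M :=
  tensor_hom_ext_of_span hσ.span_eq_top fun h hh k hk => by
    have hg := (hσ.groupLike h hh).tmul (hσ.groupLike k hk)
    rw [conv_apply_groupLike _ _ hg, convUnit_apply_groupLike hg, LinearMap.comp_apply,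
      LinearMap.comp_apply, Algebra.linearMap_apply, Algebra.linearMap_apply, ← map_mul,
      mul_comm, hσ.mul_inv h hh k hk, map_one]

theorem IsScalarCocycleOn.apply_one_eq_counit (hσ : IsScalarCocycleOn P σ σ') (h : H) :
    σ (h ⊗ₜ 1) = counit h := by
  refine LinearMap.congr_fun (f := σ ∘ₗ (TensorProduct.mk κ H H).flip 1) (g := counit)
    (LinearMap.ext_on hσ.span_eq_top fun x hx => ?_) h
  exact (hσ.apply_one x hx).trans (hσ.groupLike x hx).counit_eq_one.symm

theorem IsScalarCocycleOn.one_apply_eq_counit (hσ : IsScalarCocycleOn P σ σ') (h : H) :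
    σ (1 ⊗ₜ h) = counit h := by
  refine LinearMap.congr_fun (f := σ ∘ₗ TensorProduct.mk κ H H 1) (g := counit)
    (LinearMap.ext_on hσ.span_eq_top fun x hx => ?_) h
  exact (hσ.one_apply x hx).trans (hσ.groupLike x hx).counit_eq_one.symm

/-- Only the invariance of scalars under the group-like elements matters. The algebra `M` is left
general because the use below is for multipliers. -/
theorem IsScalarCocycleOn.cocycle_algebraMap (hσ : IsScalarCocycleOn P σ σ')
    {act : H →ₗ[κ] M →ₗ[κ] M} (hact : ∀ h ∈ P, ∀ c, act h (algebraMap κ M c) = algebraMap κ M c) :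
    actOn act (Algebra.linearMap κ M ∘ₗ σ) ∗ᶜ precompMulRight (Algebra.linearMap κ M ∘ₗ σ) =
      precompFirstTwo (Algebra.linearMap κ M ∘ₗ σ) ∗ᶜ
        precompMulLeft (Algebra.linearMap κ M ∘ₗ σ) := by
  refine tensor_tensor_hom_ext_of_span hσ.span_eq_top fun h hh k hk l hl => ?_
  have hg := (hσ.groupLike h hh).tmul ((hσ.groupLike k hk).tmul (hσ.groupLike l hl))
  rw [conv_apply_groupLike _ _ hg, conv_apply_groupLike _ _ hg, actOn_tmul,
    precompMulRight_tmul, precompMulLeft_tmul, precompFirstTwo_tmul _ _ _ (hσ.groupLike l hl)]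
  simp only [LinearMap.comp_apply, Algebra.linearMap_apply, hact h hh, ← map_mul,
    hσ.cocycle h hh k hk l hl]

end Algebra

variable {B : Type*} [Ring B] [Algebra κ B] {act : H →ₗ[κ] B →ₗ[κ] B}

theorem IsModuleAlgebra.act_mul_groupLike (hact : IsModuleAlgebra act) {h : H}
    (hh : IsGroupLikeElem κ h) (a b : B) : act h (a * b) = act h a * act h b :=
  (LinearMap.congr_fun (hact.act_mul a b) h).trans (conv_apply_groupLike _ _ hh)

theorem IsModuleAlgebra.act_antipode_cancel (hact : IsModuleAlgebra act) {h : H}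
    (hh : IsGroupLikeElem κ h) (b : B) : act h (act (antipode κ h) b) = b := by
  rw [← hact.mul_act, hh.mul_antipode_cancel, hact.one_act]

theorem IsModuleAlgebra.unitalMultAct_algebraMap (hact : IsModuleAlgebra act) {h : H}
    (hh : IsGroupLikeElem κ h) (c : κ) :
    unitalMultAct act h (algebraMap κ _ c) = algebraMap κ (multiplierAlgebra κ B) c := by
  rw [Algebra.algebraMap_eq_smul_one, map_smul, unitalMultAct_apply, mulLeftMultiplier_one,
    hact.act_one, hh.counit_eq_one, one_smul, toMultiplier_one]

/-- The twisted action of `H` on a module algebra given by a scalar cocycle. -/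
def IsModuleAlgebra.twistedAction (hact : IsModuleAlgebra act)
    (hσ : IsScalarCocycleOn P σ σ') : TwistedAction κ H B where
  act := act
  one_act := hact.one_act
  act_mul := hact.act_mul
  act_unit i hi h := by
    -- A unital algebra has only one unit.
    obtain rfl : i = 1 := by simpa using (hi 1).1
    exact hact.act_one h
  antipodeInv := antipode κ
  antipodeInv_antipode := hσ.antipode_antipode
  antipode_antipodeInv := hσ.antipode_antipode
  multAct := unitalMultAct act
  multAct_left x b := LinearMap.ext_on hσ.span_eq_top fun h hh => by
    have hg := hσ.groupLike h hh
    rw [convPair_apply_groupLike _ _ _ hg]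
    simp only [LinearMap.comp_apply, LinearMap.flip_apply, LinearMap.id_apply,
      unitalMultAct_apply, mulLeftMultiplier_toMultiplier]
    -- With `x` replaced by multiplication by `x1`, the element `h` acts on both factors, and on the
    -- second one it cancels the action of its antipode.
    rw [mulLeftMultiplier_eq_mul x (act _ b), hact.act_mul_groupLike hg,
      hact.act_antipode_cancel hg]
  multAct_right x b := LinearMap.ext_on hσ.span_eq_top fun h hh => by
    have hg := hσ.groupLike h hh
    rw [convPair_apply_groupLike _ _ _ hg]
    simp only [LinearMap.comp_apply, LinearMap.flip_apply, LinearMap.id_apply,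
      unitalMultAct_apply, mulRightMultiplier_toMultiplier]
    rw [mulRightMultiplier_eq_mul x, hact.act_mul_groupLike hg, hact.act_antipode_cancel hg]
  u := Algebra.linearMap κ (multiplierAlgebra κ B) ∘ₗ σ
  uInv := Algebra.linearMap κ (multiplierAlgebra κ B) ∘ₗ σ'
  mul_inv := hσ.conv_algebraMap
  inv_mul := hσ.conv_algebraMap_inv
  apply_one h := congrArg (algebraMap κ _) (hσ.apply_one_eq_counit h)
  one_apply h := congrArg (algebraMap κ _) (hσ.one_apply_eq_counit h)
  twisted a := tensor_hom_ext_of_span hσ.span_eq_top fun h hh k hk => by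
    have hg := (hσ.groupLike h hh).tmul (hσ.groupLike k hk)
    -- The cocycle value is a scalar, so it acts alike from the left and from the right. What
    -- remains is `(hk) ▷ a = h ▷ (k ▷ a)`.
    rw [convPair_apply_groupLike _ _ _ hg, convPair_apply_groupLike _ _ _ hg, actOn_tmul,
      mulActOn_tmul, hact.mul_act]
    rfl
  cocycle := hσ.cocycle_algebraMap (M := multiplierAlgebra κ B) fun h hh =>
    hact.unitalMultAct_algebraMap (hσ.groupLike h hh)

theorem IsModuleAlgebra.twistedAction_inducedAct (hact : IsModuleAlgebra act)
    (hσ : IsScalarCocycleOn P σ σ') (i : B) (h : H) (b : B) :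
    (hact.twistedAction hσ).inducedAct i h b = i * act h b := rfl

/-- A globalization given by a module algebra and a scalar cocycle. -/
def IsModuleAlgebra.globalization (hact : IsModuleAlgebra act) (hσ : IsScalarCocycleOn P σ σ')
    {A : Type*} [Ring A] [Algebra κ A] {α : H →ₗ[κ] A →ₗ[κ] A} {ω ω' : H ⊗[κ] H →ₗ[κ] A}
    (φ : A →ₙₐ[κ] B) (hφ : Function.Injective φ) (mul_mem : ∀ a b, φ a * b ∈ Set.range φ)
    (mem_mul : ∀ a b, b * φ a ∈ Set.range φ) (map_act : ∀ h a, φ (α h a) = φ 1 * act h (φ a))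
    (hω : ∀ h ∈ P, ∀ k ∈ P, φ (ω (h ⊗ₜ k)) =
      σ (h ⊗ₜ k) • (φ 1 * act h (φ 1) * (φ 1 * act (h * k) (φ 1))))
    (hω' : ∀ h ∈ P, ∀ k ∈ P, φ (ω' (h ⊗ₜ k)) =
      σ' (h ⊗ₜ k) • (φ 1 * act (h * k) (φ 1) * (φ 1 * act h (φ 1)))) :
    Globalization α ω ω' B where
  toTwistedAction := hact.twistedAction hσ
  φ := φ
  injective := hφ
  mul_mem := mul_mem
  mem_mul := mem_mul
  map_act h a := by rw [hact.twistedAction_inducedAct hσ, map_act]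
  map_cocycle x := by
    refine LinearMap.congr_fun (f := (φ : A →ₗ[κ] B) ∘ₗ ω)
      (tensor_hom_ext_of_span hσ.span_eq_top fun h hh k hk => (hω h hh k hk).trans ?_) x
    exact ((hact.twistedAction hσ).inducedCocycle_groupLike _ (hσ.groupLike h hh)
      (hσ.groupLike k hk) rfl).symm
  map_cocycle_inv x := by
    refine LinearMap.congr_fun (f := (φ : A →ₗ[κ] B) ∘ₗ ω')
      (tensor_hom_ext_of_span hσ.span_eq_top fun h hh k hk => (hω' h hh k hk).trans ?_) x
    exact ((hact.twistedAction hσ).inducedCocycleInv_groupLike _ (hσ.groupLike h hh)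
      (hσ.groupLike k hk) rfl).symm

end ScalarGlobalization

/-! ### The globalization of the example. -/

noncomputable section GlobalExample

variable {κ : Type*} [Field κ] (e : ℂ ≃+* κ) {S : Subgroup Circle} {n : ℕ}
  {G : Subgroup (Equiv.Perm (Fin n))}

variable (κ S G) in
theorem span_torusElem :
    Submodule.span κ (Set.range fun p : (Fin n → S) × G => torusElem κ S G p.1 p.2) = ⊤ := by
  -- The quotient map by the span vanishes on all `χ ⊗ u_g`, hence everywhere by extensionality.
  rw [← Submodule.ker_mkQ (Submodule.span κ _), LinearMap.ker_eq_top]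
  refine torusSmash_hom_ext fun χ g => (Submodule.Quotient.mk_eq_zero _).mpr ?_
  exact Submodule.subset_span ⟨(χ, g), rfl⟩

/-- The linear map with `(h, l) ↦ γ(g, s) ε(h) ε(l)` for `h = χ ⊗ u_g`, `l = χ' ⊗ u_s`. -/
def scalarCocycle (S : Subgroup Circle) (γ : G → G → κ) :
    TorusSmash κ S G ⊗[κ] TorusSmash κ S G →ₗ[κ] κ :=
  counit.comp (twistMap γ)

theorem scalarCocycle_torusElem (γ : G → G → κ) (χ χ' : Fin n → S) (g s : G) :
    scalarCocycle S γ (torusElem κ S G χ g ⊗ₜ torusElem κ S G χ' s) = γ g s := by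
  rw [scalarCocycle, LinearMap.comp_apply, twistMap_tmul, map_smul,
    ((isGroupLikeElem_torusElem χ g).tmul (isGroupLikeElem_torusElem χ' s)).counit_eq_one,
    smul_eq_mul, mul_one]

variable {γ : G → G → κˣ}

theorem isScalarCocycleOn_torusElem (S : Subgroup Circle) (hγ : IsNormalizedTwoCocycle γ) :
    IsScalarCocycleOn (Set.range fun p : (Fin n → S) × G => torusElem κ S G p.1 p.2)
      (scalarCocycle S fun g s => (γ g s : κ)) (scalarCocycle S fun g s => ((γ g s)⁻¹ : κ)) where
  span_eq_top := span_torusElem κ S G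
  groupLike := by
    rintro _ ⟨p, rfl⟩
    exact isGroupLikeElem_torusElem _ _
  mul_inv := by
    rintro _ ⟨p, rfl⟩ _ ⟨q, rfl⟩
    simp [scalarCocycle_torusElem]
  apply_one := by
    rintro _ ⟨p, rfl⟩
    simp [← torusElem_one, scalarCocycle_torusElem, hγ.apply_one]
  one_apply := by
    rintro _ ⟨p, rfl⟩
    simp [← torusElem_one, scalarCocycle_torusElem, hγ.one_apply]
  cocycle := by
    rintro _ ⟨p, rfl⟩ _ ⟨q, rfl⟩ _ ⟨r, rfl⟩
    simp only [scalarCocycle_torusElem, torusElem_mul]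
    exact_mod_cast congrArg Units.val (hγ.cocycle p.2 q.2 r.2)

variable (S) in
theorem isModuleAlgebra_exampleAct_univ :
    IsModuleAlgebra (exampleAct (S := S) e (Set.univ : Set G)) where
  one_act := exampleAct_one_elem e Set.univ
  mul_act := exampleAct_univ_mul_elem e
  act_mul := (isPartialAction_exampleAct e Set.univ).act_mul
  act_one := exampleAct_univ_one_eq_counit e

variable (X : Set G)

/-- Both actions use the same scalar and the same translate. They differ only when the translate
leaves `X`, and `φ(1)` removes exactly those terms. -/
theorem inclAPrime_exampleAct (h : TorusSmash κ S G) (a : APrime κ X) :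
    inclAPrime κ X (exampleAct e X h a) =
      inclAPrime κ X 1 * exampleAct e Set.univ h (inclAPrime κ X a) := by
  refine LinearMap.congr_fun₂
    (f := (exampleAct e X).compr₂ (resAPrime X Set.univ))
    (g := ((exampleAct e Set.univ).compl₂ (resAPrime X Set.univ)).compr₂
      (LinearMap.mulLeft κ (inclAPrime κ X 1)))
    (torusSmash_hom_ext fun χ g => aPrime_hom_ext fun k s hs => ?_) h a
  rw [LinearMap.compr₂_apply, LinearMap.compr₂_apply, LinearMap.compl₂_apply,
    LinearMap.mulLeft_apply, resAPrime_basis X _ _ hs, exampleAct_basisAPrime e X _ _ _ hs,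
    exampleAct_basisAPrime e _ _ _ _ (Set.mem_univ s), ← inclAPrime_resAPrime, map_smul,
    map_smul, map_smul, resAPrime_basis _ X _ (Set.mem_univ _)]
  rfl

theorem inclAPrime_exampleCocycle (γ : G → G → κ) (χ : Fin n → S) (g : G) (χ' : Fin n → S)
    (g' : G) :
    inclAPrime κ X (exampleCocycle e X γ (torusElem κ S G χ g ⊗ₜ torusElem κ S G χ' g')) =
      γ g g' • (inclAPrime κ X 1 *
        exampleAct e Set.univ (torusElem κ S G χ g) (inclAPrime κ X 1) *
        (inclAPrime κ X 1 * exampleAct e Set.univ (torusElem κ S G χ g * torusElem κ S G χ' g')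
          (inclAPrime κ X 1))) := by
  rw [exampleCocycle_torusElem, map_smul, map_mul, inclAPrime_exampleAct, inclAPrime_exampleAct]

/-- The globalization of the partial action on `A'`. -/
def exampleGlobalization (S : Subgroup Circle) (hγ : IsNormalizedTwoCocycle γ) :
    Globalization (exampleAct (S := S) e X)
      (exampleCocycle e X fun g s => (γ g s : κ))
      (exampleCocycle e X fun g s => ((γ g s)⁻¹ : κ)) (APrime κ (Set.univ : Set G)) :=
  (isModuleAlgebra_exampleAct_univ e S).globalization (isScalarCocycleOn_torusElem S hγ)
    (inclAPrime κ X) (inclAPrime_injective X) (inclAPrime_mul_mem X)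
    (fun a b => mul_comm (inclAPrime κ X a) b ▸ inclAPrime_mul_mem X a b)
    (inclAPrime_exampleAct e X)
    (by
      rintro _ ⟨p, rfl⟩ _ ⟨q, rfl⟩
      rw [scalarCocycle_torusElem]
      exact inclAPrime_exampleCocycle e X _ _ _ _ _)
    (by
      rintro _ ⟨p, rfl⟩ _ ⟨q, rfl⟩
      rw [scalarCocycle_torusElem]
      -- The induced inverse cocycle has its two outer idempotents in the opposite order, which is
      -- harmless because `B` is commutative.
      exact (inclAPrime_exampleCocycle e X _ _ _ _ _).trans (congrArg _ (mul_comm _ _)))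

end GlobalExample

theorem mainTheorem6 {κ : Type*} [Field κ] (e : ℂ ≃+* κ) (S : Subgroup Circle) (n : ℕ)
    (G : Subgroup (Equiv.Perm (Fin n))) (X : Set G) (hX : ∀ K : Subgroup G, (K : Set G) ≠ X)
    (γ : G → G → κˣ) (hγ : IsNormalizedTwoCocycle γ) (hγ' : ¬ IsTwoCoboundary γ) :
    Coalgebra.IsCocomm κ (TorusSmash κ S G) ∧
    IsPartialAction (exampleAct (S := S) e X) ∧
    IsSymmetricTwistedPartialAction (exampleAct (S := S) e X)
      (exampleCocycle e X fun g s => (γ g s : κ))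
      (exampleCocycle e X fun g s => ((γ g s)⁻¹ : κ)) ∧
    IsGlobalizingMap (exampleAct (S := S) e X)
      (exampleCocycle e X fun g s => (γ g s : κ))
      (exampleCocycle e X fun g s => ((γ g s)⁻¹ : κ))
      (exampleMap X fun g s => (γ g s : κ))
      (exampleMap X fun g s => ((γ g s)⁻¹ : κ)) ∧
    IsGlobalizable (exampleAct (S := S) e X)
      (exampleCocycle e X fun g s => (γ g s : κ))
      (exampleCocycle e X fun g s => ((γ g s)⁻¹ : κ)) :=
  ⟨isCocomm_torusSmash, isPartialAction_exampleAct e X,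
    isSymmetricTwistedPartialAction_example e X hγ, isGlobalizingMap_example e X hγ,
    APrime κ (Set.univ : Set G), inferInstance, inferInstance, inferInstance, inferInstance,
    ⟨exampleGlobalization e X S hγ⟩⟩
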